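/- Let $\mathfrak n$ be a real Lie algebra of dimension $8$ which is filiform, i.e. nilpotent of step exactly $7$, and which admits an $\mathbb N$-gradation, i.e. a vector space decomposition $\mathfrak n=\bigoplus_{i\ge 1}\mathfrak n_i$ indexed by the positive integers such that $[\mathfrak n_i,\mathfrak n_j]\subseteq\mathfrak n_{i+j}$ for all $i,j\geq 1$. Then $\mathfrak n$ is isomorphic, as a real Lie algebra, to one and only one of the following Lie algebras $(\mathbb R^8,\mu)$, where different values of the parameter $\alpha$ (respectively $t$) count as different algebras of the list. Conversely, each algebra of the list is an $8$-dimensional filiform real Lie algebra that admits an $\mathbb N$-gradation. Here $e_1,\dots,e_8$ is the standard basis of $\mathbb R^8$, $\mu$ is bilinear and skew-symmetric, and the brackets $\mu(e_i,e_j)$ that are not determined by those listed and by skew-symmetry are zero. Algebras with $\mu(e_1,e_i)=e_{i+1}$ for $i=2,\dots,7$ and, in addition: - $\mathfrak m_0(8)$: no further brackets; - $\mathfrak m_1(8)$: $\mu(e_i,e_{9-i})=(-1)^i e_8$ for $i=2,\dots,7$; - $\mathfrak m_2(8)$: $\mu(e_2,e_i)=e_{i+2}$ for $i=3,\dots,6$;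 - $\mathfrak g_\alpha(8)$, $\alpha\in\mathbb R$: $\mu(e_2,e_3)=(2+\alpha)e_5$, $\mu(e_2,e_4)=(2+\alpha)e_6$, $\mu(e_2,e_5)=(1+\alpha)e_7$, $\mu(e_2,e_6)=\alpha e_8$, $\mu(e_3,e_4)=e_7$, $\mu(e_3,e_5)=e_8$; - $\mathfrak a_t(8)$, $t\in\mathbb R$: $\mu(e_2,e_3)=(t+1)e_6$, $\mu(e_2,e_4)=(t+1)e_7$, $\mu(e_2,e_5)=t e_8$, $\mu(e_3,e_4)=e_8$; - $\mathfrak c_{1,0}(8)$: $\mu(e_2,e_3)=e_6$, $\mu(e_2,e_4)=e_7$, $\mu(e_2,e_5)=e_8$; - $\mathfrak d_1(8)$: $\mu(e_2,e_3)=e_7$, $\mu(e_2,e_4)=e_8$; - $\mathfrak h_1(8)$: $\mu(e_2,e_3)=e_8$. Algebras with $\mu(e_1,e_i)=e_{i+1}$ for $i=2,\dots,6$ and $\mu(e_i,e_{9-i})=(-1)^{i+1}e_8$ for $i=2,3,4$ and, in addition: - $\mathfrak b(8)$: $\mu(e_2,e_3)=-\tfrac12 e_5$, $\mu(e_2,e_4)=-\tfrac12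 e_6$, $\mu(e_2,e_5)=-\tfrac32 e_7$, $\mu(e_3,e_4)=e_7$; - $\mathfrak k_1(8)$: $\mu(e_2,e_3)=e_6$, $\mu(e_2,e_4)=e_7$; - $\mathfrak s_1(8)$: $\mu(e_2,e_3)=e_7$. -/

import Mathlib

namespace FiliformGraded

/-- A finite-dimensional real Lie algebra of dimension `n` is filiform if it is nilpotent of step
exactly `n - 1`: in the descending central series `C₀ = L`, `Cᵢ₊₁ = [L, Cᵢ]`, the first term that
vanishes is `Cₙ₋₁`. -/
def IsFiliform (L : Type*) [LieRing L] [LieAlgebra ℝ L] : Prop :=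
  FiniteDimensional ℝ L ∧ LieRing.IsNilpotent L ∧
    LieModule.nilpotencyLength L L + 1 = Module.finrank ℝ L

/-- An `ℕ`-gradation of a real Lie algebra, the degrees being positive integers: a direct sum
decomposition `L = ⨁ 𝒱 i` into subspaces such that `⁅𝒱 i, 𝒱 j⁆ ⊆ 𝒱 (i + j)`. (If `L` is
finite-dimensional, only finitely many `𝒱 i` are nonzero.) -/
def AdmitsNGradation (L : Type*) [LieRing L] [LieAlgebra ℝ L] : Prop :=
  ∃ 𝒱 : ℕ+ → Submodule ℝ L, DirectSum.IsInternal 𝒱 ∧ SetLike.GradedBracket 𝒱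

/-- The names of the algebras of the table, the members of the two curves being listed
separately for each value of the real parameter. -/
inductive TableName : Type
  | m0
  | m1
  | m2
  | g (α : ℝ)
  | a (t : ℝ)
  | c10
  | d1
  | h1
  | b
  | k1
  | s1

/-- A bracket relation `μ(e_i, e_j) = c e_k`, with `1 ≤ i < j ≤ 8` and `1 ≤ k ≤ 8`. -/
structure Relation where
  i : ℕ
  j : ℕ
  c : ℝ
  k : ℕ

/-- The relations `μ(e_1, e_i) = e_{i+1}` for `i = 2, …, 6`. -/
noncomputable def chain6 : List Relation :=
  [⟨1, 2, 1, 3⟩, ⟨1, 3, 1, 4⟩, ⟨1, 4, 1, 5⟩, ⟨1, 5, 1, 6⟩, ⟨1, 6, 1, 7⟩]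

/-- The relations `μ(e_1, e_i) = e_{i+1}` for `i = 2, …, 7`. -/
noncomputable def chain7 : List Relation := chain6 ++ [⟨1, 7, 1, 8⟩]

/-- The nonzero brackets `μ(e_i, e_j)`, `i < j`, of the algebras of the table. -/
noncomputable def relations : TableName → List Relation
  | .m0 => chain7
  | .m1 => chain7 ++ [⟨2, 7, 1, 8⟩, ⟨3, 6, -1, 8⟩, ⟨4, 5, 1, 8⟩]
  | .m2 => chain7 ++ [⟨2, 3, 1, 5⟩, ⟨2, 4, 1, 6⟩, ⟨2, 5, 1, 7⟩, ⟨2, 6, 1, 8⟩]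
  | .g α => chain7 ++ [⟨2, 3, 2 + α, 5⟩, ⟨2, 4, 2 + α, 6⟩, ⟨2, 5, 1 + α, 7⟩, ⟨2, 6, α, 8⟩,
      ⟨3, 4, 1, 7⟩, ⟨3, 5, 1, 8⟩]
  | .a t => chain7 ++ [⟨2, 3, t + 1, 6⟩, ⟨2, 4, t + 1, 7⟩, ⟨2, 5, t, 8⟩, ⟨3, 4, 1, 8⟩]
  | .c10 => chain7 ++ [⟨2, 3, 1, 6⟩, ⟨2, 4, 1, 7⟩, ⟨2, 5, 1, 8⟩]
  | .d1 => chain7 ++ [⟨2, 3, 1, 7⟩, ⟨2, 4, 1, 8⟩]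
  | .h1 => chain7 ++ [⟨2, 3, 1, 8⟩]
  | .b => chain6 ++ [⟨2, 3, -1 / 2, 5⟩, ⟨2, 4, -1 / 2, 6⟩, ⟨2, 5, -3 / 2, 7⟩, ⟨3, 4, 1, 7⟩,
      ⟨2, 7, -1, 8⟩, ⟨3, 6, 1, 8⟩, ⟨4, 5, -1, 8⟩]
  | .k1 => chain6 ++ [⟨2, 3, 1, 6⟩, ⟨2, 4, 1, 7⟩, ⟨2, 7, -1, 8⟩, ⟨3, 6, 1, 8⟩, ⟨4, 5, -1, 8⟩]
  | .s1 => chain6 ++ [⟨2, 3, 1, 7⟩, ⟨2, 7, -1, 8⟩, ⟨3, 6, 1, 8⟩, ⟨4, 5, -1, 8⟩]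

/-- The position in `Fin 8` (which counts from `0`) of the `i`-th coordinate, `1 ≤ i ≤ 8`. -/
def pos (i : ℕ) : Fin 8 := Fin.ofNat 8 (i - 1)

/-- The basis vector `e_k` of `ℝ⁸`, `1 ≤ k ≤ 8`. -/
noncomputable def e (k : ℕ) : Fin 8 → ℝ := Pi.single (pos k) 1

/-- The skew-symmetric bilinear map on `ℝ⁸` with `μ(e_i, e_j) = c e_k = -μ(e_j, e_i)` for each
listed relation and `μ(e_i, e_j) = 0` for the other pairs. -/
noncomputable def mu (l : List Relation) (x y : Fin 8 → ℝ) : Fin 8 → ℝ :=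
  (l.map fun r => (r.c * (x (pos r.i) * y (pos r.j) - x (pos r.j) * y (pos r.i))) • e r.k).sum

theorem mu_add_left (l : List Relation) (x y z : Fin 8 → ℝ) :
    mu l (x + y) z = mu l x z + mu l y z := by
  simp only [mu, ← List.sum_map_add]
  congr 2
  funext r
  rw [← add_smul]
  congr 1
  simp only [Pi.add_apply]
  ring

theorem mu_swap (l : List Relation) (x y : Fin 8 → ℝ) : mu l x y = - mu l y x := by
  induction l with
  | nil => simp [mu]
  | cons r l ih =>
    simp only [mu, List.map_cons, List.sum_cons] at ih ⊢
    rw [ih, neg_add, ← neg_smul]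
    congr 2
    ring

theorem mu_add_right (l : List Relation) (x y z : Fin 8 → ℝ) :
    mu l x (y + z) = mu l x y + mu l x z := by
  rw [mu_swap, mu_add_left, neg_add, ← mu_swap, ← mu_swap]

theorem mu_self (l : List Relation) (x : Fin 8 → ℝ) : mu l x x = 0 := by
  have h (r : Relation) : x (pos r.i) * x (pos r.j) - x (pos r.j) * x (pos r.i) = 0 := by ring
  simp [mu, h]

theorem mu_smul_right (l : List Relation) (c : ℝ) (x y : Fin 8 → ℝ) :
    mu l x (c • y) = c • mu l x y := by
  induction l with
  | nil => simp [mu]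
  | cons r l ih =>
    simp only [mu, List.map_cons, List.sum_cons] at ih ⊢
    rw [ih, smul_add, smul_smul]
    congr 2
    simp only [Pi.smul_apply, smul_eq_mul]
    ring

theorem mu_nil (x y : Fin 8 → ℝ) (m : Fin 8) : mu [] x y m = 0 := by simp [mu]

theorem mu_cons (r : Relation) (l : List Relation) (x y : Fin 8 → ℝ) (m : Fin 8) :
    mu (r :: l) x y m =
      (if m = pos r.k then r.c * (x (pos r.i) * y (pos r.j) - x (pos r.j) * y (pos r.i)) else 0) +
        mu l x y m := by
  simp [mu, e, Pi.single_apply]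

set_option maxHeartbeats 4000000 in
theorem mu_jacobi (s : TableName) (x y z : Fin 8 → ℝ) :
    mu (relations s) x (mu (relations s) y z) =
      mu (relations s) (mu (relations s) x y) z + mu (relations s) y (mu (relations s) x z) := by
  have p1 : pos 1 = 0 := rfl
  have p2 : pos 2 = 1 := rfl
  have p3 : pos 3 = 2 := rfl
  have p4 : pos 4 = 3 := rfl
  have p5 : pos 5 = 4 := rfl
  have p6 : pos 6 = 5 := rfl
  have p7 : pos 7 = 6 := rfl
  have p8 : pos 8 = 7 := rfl
  have h0 (s) (x y : Fin 8 → ℝ) : mu (relations s) x y 0 = 0 := by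
    cases s <;> simp [relations, chain7, chain6, mu_cons, mu_nil, p3, p4, p5, p6, p7, p8]
  have h1 (s) (x y : Fin 8 → ℝ) : mu (relations s) x y 1 = 0 := by
    cases s <;> simp [relations, chain7, chain6, mu_cons, mu_nil, p3, p4, p5, p6, p7, p8]
  have h2 (s) (x y : Fin 8 → ℝ) : mu (relations s) x y 2 = x 0 * y 1 - x 1 * y 0 := by
    cases s <;> simp [relations, chain7, chain6, mu_cons, mu_nil, p1, p2, p3, p4, p5, p6, p7, p8]
  have h3 (s) (x y : Fin 8 → ℝ) : mu (relations s) x y 3 = x 0 * y 2 - x 2 * y 0 := by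
    cases s <;> simp [relations, chain7, chain6, mu_cons, mu_nil, p1, p2, p3, p4, p5, p6, p7, p8]
  ext m
  cases s <;> fin_cases m
  all_goals
    simp only [Pi.add_apply, Fin.mk_zero, Fin.mk_one, Fin.reduceFinMk, Fin.zero_eta,
      Fin.isValue, h0, h1, h2, h3]
    try simp only [relations, chain7, chain6, List.cons_append, List.nil_append, mu_cons, mu_nil,
      p1, p2, p3, p4, p5, p6, p7, p8, Fin.reduceEq, if_true, if_false, Fin.isValue, h0, h1, h2, h3]
    first | done | ring

/-- The underlying vector space `ℝ⁸` of the algebra of the table with the given name. -/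
def TableAlgebra (_ : TableName) : Type := Fin 8 → ℝ

noncomputable instance (s : TableName) : AddCommGroup (TableAlgebra s) :=
  inferInstanceAs (AddCommGroup (Fin 8 → ℝ))

noncomputable instance (s : TableName) : Module ℝ (TableAlgebra s) :=
  inferInstanceAs (Module ℝ (Fin 8 → ℝ))

noncomputable instance (s : TableName) : LieRing (TableAlgebra s) where
  bracket x y := mu (relations s) x y
  add_lie x y z := mu_add_left (relations s) x y z
  lie_add x y z := mu_add_right (relations s) x y z
  lie_self x := mu_self (relations s) x
  leibniz_lie x y z := mu_jacobi s x y z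

noncomputable instance (s : TableName) : LieAlgebra ℝ (TableAlgebra s) where
  lie_smul c x y := mu_smul_right (relations s) c x y

end FiliformGraded

/-
A gradation is the same thing as a derivation that is diagonalizable with positive integers as its
eigenvalues. Choose eigenvectors `x`, `y` of it that span the algebra modulo its commutator ideal,
such that `y` centralizes `𝒞 1` modulo `𝒞 3`, where `𝒞` is the lower central series. The iterated
brackets `z k = (ad x)ᵏ y` for `k ≤ 5`, together with `x` and an eigenvector that spans `𝒞 6`, form
a basis: it could break down only if `y` did not centralize `𝒞 3` modulo `𝒞 5`, which the Jacobi
identity excludes. In such a basis the Jacobi identity expresses all brackets by eight structure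
constants, each homogeneous for the derivation. Hence a nonzero structure constant determines the
ratio `r` of the eigenvalues of `y` and `x`, and the structure constants that require another value
of `r` vanish. Multiplying the basis vectors by scalars turns the remaining ones into those of an
algebra of the table.

An isomorphism between two algebras of the table respects the lower central series, so its matrix is
triangular. Comparing coefficients shows that the leading nonzero structure constants are
multiplied by monomials in the diagonal entries, which separates the algebras of the table and the
values of the parameters.
-/

namespace FiliformGraded

open LieModule Module

section LowerCentralSeries

variable {R L : Type*} [CommRing R] [LieRing L] [LieAlgebra R L]

local notation "𝒞" => lowerCentralSeries R L L

theorem lie_mem_lowerCentralSeries_succ (x : L) {k : ℕ} {y : L} (hy : y ∈ 𝒞 k) :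
    ⁅x, y⁆ ∈ 𝒞 (k + 1) := by
  rw [lowerCentralSeries_succ]
  exact LieSubmodule.lie_mem_lie (LieSubmodule.mem_top x) hy

theorem lie_mem_lowerCentralSeries_one (x y : L) : ⁅x, y⁆ ∈ 𝒞 1 :=
  lie_mem_lowerCentralSeries_succ x (k := 0) (LieSubmodule.mem_top y)

theorem lowerCentralSeries_succ_le {k : ℕ} {W : Submodule R L}
    (h : ∀ x : L, ∀ y ∈ 𝒞 k, ⁅x, y⁆ ∈ W) : (𝒞 (k + 1)).toSubmodule ≤ W := by
  rw [lowerCentralSeries_succ, LieSubmodule.lieIdeal_oper_eq_linear_span', Submodule.span_le]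
  rintro _ ⟨x, -, y, hy, rfl⟩
  exact h x y hy

theorem lie_mem_lowerCentralSeries_add {i j : ℕ} {x y : L} (hx : x ∈ 𝒞 i) (hy : y ∈ 𝒞 j) :
    ⁅x, y⁆ ∈ 𝒞 (i + j + 1) := by
  induction i generalizing x y j with
  | zero => simpa only [zero_add] using lie_mem_lowerCentralSeries_succ x hy
  | succ i ih =>
    suffices (𝒞 (i + 1)).toSubmodule ≤
        (𝒞 (i + 1 + j + 1)).toSubmodule.comap
          ((toEnd R L L : L →ₗ[R] Module.End R L).flip y) from this hx
    refine lowerCentralSeries_succ_le fun l c hc => ?_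
    have hleft : ⁅l, ⁅c, y⁆⁆ ∈ 𝒞 (i + 1 + j + 1) := by
      rw [show i + 1 + j + 1 = i + j + 1 + 1 by omega]
      exact lie_mem_lowerCentralSeries_succ l (ih hc hy)
    have hright : ⁅c, ⁅l, y⁆⁆ ∈ 𝒞 (i + 1 + j + 1) := by
      rw [show i + 1 + j + 1 = i + (j + 1) + 1 by omega]
      exact ih hc (lie_mem_lowerCentralSeries_succ l hy)
    change ⁅⁅l, c⁆, y⁆ ∈ 𝒞 (i + 1 + j + 1)
    rw [lie_lie]
    exact sub_mem hleft hright

theorem derivation_apply_mem_lowerCentralSeries (D : LieDerivation R L L) {k : ℕ} {x : L}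
    (hx : x ∈ 𝒞 k) : D x ∈ 𝒞 k := by
  induction k generalizing x with
  | zero => exact LieSubmodule.mem_top _
  | succ k ih =>
    suffices (𝒞 (k + 1)).toSubmodule ≤ (𝒞 (k + 1)).toSubmodule.comap (D : L →ₗ[R] L) from this hx
    refine lowerCentralSeries_succ_le fun l c hc => ?_
    change D ⁅l, c⁆ ∈ 𝒞 (k + 1)
    rw [D.apply_lie_eq_add]
    exact add_mem (lie_mem_lowerCentralSeries_succ l (ih hc))
      (lie_mem_lowerCentralSeries_succ (D l) hc)

theorem lowerCentralSeries_eq_bot_of_le_succ [LieRing.IsNilpotent L] {k : ℕ}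
    (h : 𝒞 k ≤ 𝒞 (k + 1)) : 𝒞 k = ⊥ := by
  have hle (j : ℕ) : 𝒞 k ≤ 𝒞 (k + j) := by
    induction j with
    | zero => exact le_rfl
    | succ j ih =>
      refine h.trans (lowerCentralSeries_succ_le fun x y hy => ?_)
      exact lie_mem_lowerCentralSeries_succ x (ih hy)
  obtain ⟨n, hn⟩ := IsNilpotent.nilpotent R L L
  rw [eq_bot_iff, ← hn]
  exact (hle n).trans (antitone_lowerCentralSeries R L L (Nat.le_add_left n k))

theorem lowerCentralSeries_one_le_two {x : L}
    (h : Submodule.span R {x} ⊔ (𝒞 1).toSubmodule = ⊤) : 𝒞 1 ≤ 𝒞 2 := by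
  have hdecomp (u : L) : ∃ (a : R), ∃ c ∈ 𝒞 1, a • x + c = u := by
    obtain ⟨_, hu, c, hc, rfl⟩ := Submodule.mem_sup.1 (h ▸ Submodule.mem_top : u ∈ _)
    obtain ⟨a, rfl⟩ := Submodule.mem_span_singleton.1 hu
    exact ⟨a, c, hc, rfl⟩
  refine lowerCentralSeries_succ_le fun u v _ => ?_
  obtain ⟨a, c, hc, rfl⟩ := hdecomp u
  obtain ⟨b, d, hd, rfl⟩ := hdecomp v
  have hlie : ⁅a • x + c, b • x + d⁆ = ⁅a • x + c, d⁆ - b • ⁅x, c⁆ := by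
    simp only [add_lie, lie_add, smul_lie, lie_smul, lie_self, ← lie_skew x c]
    module
  rw [hlie]
  exact sub_mem (lie_mem_lowerCentralSeries_succ _ hd)
    ((𝒞 2).smul_mem b (lie_mem_lowerCentralSeries_succ x hc))

end LowerCentralSeries

section LinearAlgebra

variable {K V : Type*} [Field K] [AddCommGroup V] [Module K V]

theorem exists_mem_notMem_of_span_eq_top {S : Set V} (hS : Submodule.span K S = ⊤)
    {W : Submodule K V} (hW : W ≠ ⊤) : ∃ x ∈ S, x ∉ W := by
  by_contra! h
  exact hW (top_le_iff.1 (hS ▸ Submodule.span_le.2 h))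

theorem exists_sub_smul_mem_of_finrank_eq_succ [FiniteDimensional K V] {U W : Submodule K V}
    (hWU : W ≤ U) (hd : finrank K U = finrank K W + 1) {v : V} (hvU : v ∈ U) (hvW : v ∉ W)
    {u : V} (hu : u ∈ U) : ∃ a : K, u - a • v ∈ W := by
  have hlt := Submodule.finrank_lt_finrank_of_lt (Submodule.covBy_span_singleton_sup hvW).lt
  have hle : Submodule.span K {v} ⊔ W ≤ U :=
    sup_le ((Submodule.span_singleton_le_iff_mem v U).2 hvU) hWU
  rw [← Submodule.eq_of_le_of_finrank_le hle (by omega)] at hu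
  obtain ⟨_, ha, w, hw, rfl⟩ := Submodule.mem_sup.1 hu
  obtain ⟨a, rfl⟩ := Submodule.mem_span_singleton.1 ha
  exact ⟨a, by rwa [add_sub_cancel_left]⟩

theorem eq_of_mul_sub_eq_zero {a b c : K} (h : a * (b - c) = 0) (ha : a ≠ 0) : b = c :=
  sub_eq_zero.1 ((mul_eq_zero.1 h).resolve_left ha)

theorem mul_sub_eq_zero_of_sub_smul_mem {f : V →ₗ[K] V} {W : Submodule K V}
    (hW : ∀ w ∈ W, f w ∈ W) {u v : V} {a μ ν : K} (hv : v ∉ W) (hfu : f u = μ • u)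
    (hfv : f v = ν • v) (h : u - a • v ∈ W) : a * (ν - μ) = 0 := by
  have hmem : μ • (u - a • v) - f (u - a • v) ∈ W := sub_mem (W.smul_mem μ h) (hW _ h)
  have heq : μ • (u - a • v) - f (u - a • v) = (a * (ν - μ)) • v := by
    rw [map_sub, map_smul, hfu, hfv]
    module
  by_contra h0
  exact hv ((W.smul_mem_iff h0).1 (heq ▸ hmem))

theorem map_sub_smul_eq_smul_of_mul_sub_eq_zero {f : V →ₗ[K] V} {u v : V} {a μ ν : K}
    (hfu : f u = μ • u) (hfv : f v = ν • v) (h : a * (ν - μ) = 0) :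
    f (u - a • v) = μ • (u - a • v) := by
  have heq : f (u - a • v) - μ • (u - a • v) = -(a * (ν - μ)) • v := by
    rw [map_sub, map_smul, hfu, hfv]
    module
  rw [← sub_eq_zero, heq, h, neg_zero, zero_smul]

theorem equivFun_apply_eq_mul {ι : Type*} [Finite ι] (B : Basis ι K V) {f : V →ₗ[K] V}
    {w : ι → K} (hf : ∀ i, f (B i) = w i • B i) (u : V) :
    B.equivFun (f u) = w * B.equivFun u := by
  have := Fintype.ofFinite ι
  rw [← LinearEquiv.eq_symm_apply, B.equivFun_symm_apply]
  conv_lhs => rw [← B.sum_equivFun u, map_sum]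
  refine Finset.sum_congr rfl fun i _ => ?_
  rw [map_smul, hf, smul_smul, Pi.mul_apply, mul_comm]

end LinearAlgebra

section Filiform

variable {K L : Type*} [Field K] [LieRing L] [LieAlgebra K L]

local notation "𝒞" => lowerCentralSeries K L L

theorem lowerCentralSeries_ne_bot [LieRing.IsNilpotent L] {k : ℕ}
    (hk : k < nilpotencyLength L L) : 𝒞 k ≠ ⊥ := by
  obtain ⟨c, hc⟩ := Nat.exists_eq_add_of_lt hk
  intro h
  refine ((nilpotencyLength_eq_succ_iff K L L (k + c)).1 hc).2 (le_bot_iff.1 ?_)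
  exact h ▸ antitone_lowerCentralSeries K L L (Nat.le_add_right k c)

variable (K L) in
theorem lowerCentralSeries_nilpotencyLength [LieRing.IsNilpotent L] :
    𝒞 (nilpotencyLength L L) = ⊥ := by
  rcases h : nilpotencyLength L L with - | k
  · have := (nilpotencyLength_eq_zero_iff L L).1 h
    exact Subsingleton.elim _ _
  · exact ((nilpotencyLength_eq_succ_iff K L L k).1 h).1

theorem not_lowerCentralSeries_le_succ [LieRing.IsNilpotent L] {k : ℕ}
    (hk : k < nilpotencyLength L L) : ¬ 𝒞 k ≤ 𝒞 (k + 1) := fun h =>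
  lowerCentralSeries_ne_bot hk (lowerCentralSeries_eq_bot_of_le_succ h)

theorem span_singleton_sup_lowerCentralSeries_one_ne_top [LieRing.IsNilpotent L]
    (hL : 1 < finrank K L) (x : L) : Submodule.span K {x} ⊔ (𝒞 1).toSubmodule ≠ ⊤ := by
  intro h
  have hbot : 𝒞 1 = ⊥ := lowerCentralSeries_eq_bot_of_le_succ (lowerCentralSeries_one_le_two h)
  rw [hbot, LieSubmodule.bot_toSubmodule, sup_bot_eq] at h
  have hle := finrank_span_le_card (R := K) ({x} : Set L)
  rw [h, finrank_top, Set.toFinset_singleton, Finset.card_singleton] at hle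
  omega

variable [FiniteDimensional K L] [LieRing.IsNilpotent L]

theorem finrank_lowerCentralSeries_add_le {i j : ℕ} (h : i + j ≤ nilpotencyLength L L) :
    finrank K (𝒞 (i + j)) + j ≤ finrank K (𝒞 i) := by
  induction j with
  | zero => exact le_rfl
  | succ j ih =>
    have hlt : finrank K (𝒞 (i + j + 1)) < finrank K (𝒞 (i + j)) :=
      Submodule.finrank_lt_finrank_of_lt <|
        lt_of_le_not_ge (antitone_lowerCentralSeries K L L (i + j).le_succ)
          (not_lowerCentralSeries_le_succ (K := K) (by omega))
    have hle := ih (by omega)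
    rw [← add_assoc i j 1]
    omega

theorem finrank_lowerCentralSeries_one_add_two_le (hL : 1 < finrank K L) :
    finrank K (𝒞 1) + 2 ≤ finrank K L := by
  have hne := span_singleton_sup_lowerCentralSeries_one_ne_top hL
  obtain ⟨x, -, hx⟩ := exists_mem_notMem_of_span_eq_top (K := K) (S := Set.univ) (V := L)
    Submodule.span_univ (W := (𝒞 1).toSubmodule) fun h => hne 0 (by rw [h, sup_top_eq])
  have h₁ := Submodule.finrank_lt_finrank_of_lt (Submodule.covBy_span_singleton_sup hx).lt
  have h₂ := Submodule.finrank_lt (hne x)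
  change finrank K (𝒞 1).toSubmodule + 2 ≤ _
  omega

variable (hfil : nilpotencyLength L L + 1 = finrank K L)
include hfil

theorem finrank_lowerCentralSeries {k : ℕ} (hk : 1 ≤ k) (hkc : k ≤ nilpotencyLength L L) :
    finrank K (𝒞 k) + k + 1 = finrank K L := by
  have h₁ := finrank_lowerCentralSeries_one_add_two_le (K := K) (L := L) (by omega)
  have h₂ := finrank_lowerCentralSeries_add_le (K := K) (L := L) (i := 1) (j := k - 1) (by omega)
  have h₃ := finrank_lowerCentralSeries_add_le (K := K) (L := L) (i := k)
    (j := nilpotencyLength L L - k) (by omega)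
  rw [Nat.add_sub_cancel' hk] at h₂
  omega

theorem exists_sub_smul_mem_lowerCentralSeries_succ {k : ℕ} (hk : 1 ≤ k)
    (hkc : k < nilpotencyLength L L) {u v : L} (hv : v ∈ 𝒞 k) (hv' : v ∉ 𝒞 (k + 1))
    (hu : u ∈ 𝒞 k) : ∃ a : K, u - a • v ∈ 𝒞 (k + 1) := by
  have h₁ : finrank K (𝒞 k).toSubmodule + k + 1 = _ := finrank_lowerCentralSeries hfil hk hkc.le
  have h₂ : finrank K (𝒞 (k + 1)).toSubmodule + (k + 1) + 1 = _ :=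
    finrank_lowerCentralSeries hfil (Nat.succ_pos k) hkc
  exact exists_sub_smul_mem_of_finrank_eq_succ
    (antitone_lowerCentralSeries K L L (Nat.le_add_right k 1)) (by omega) hv hv' hu

end Filiform

section GeneratingPair

variable {K L : Type*} [Field K] [LieRing L] [LieAlgebra K L]

local notation "𝒞" => lowerCentralSeries K L L

variable (K) in
/-- Two elements that span the Lie algebra modulo its commutator ideal; for a nilpotent Lie algebra
this amounts to their being generators. -/
def IsGeneratingPair (x y : L) : Prop :=
  Submodule.span K {x, y} ⊔ (𝒞 1).toSubmodule = ⊤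

namespace IsGeneratingPair

variable {x y : L}

theorem exists_eq (h : IsGeneratingPair K x y) (u : L) :
    ∃ a b : K, ∃ d ∈ 𝒞 1, u = a • x + b • y + d := by
  obtain ⟨_, hu, d, hd, rfl⟩ := Submodule.mem_sup.1 (h ▸ Submodule.mem_top : u ∈ _)
  obtain ⟨a, b, rfl⟩ := Submodule.mem_span_pair.1 hu
  exact ⟨a, b, d, hd, rfl⟩

theorem symm (h : IsGeneratingPair K x y) : IsGeneratingPair K y x := by
  rwa [IsGeneratingPair, Set.pair_comm]

theorem sub_smul (h : IsGeneratingPair K x y) (c : K) : IsGeneratingPair K x (y - c • x) := by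
  have hx : x ∈ Submodule.span K {x, y - c • x} := Submodule.mem_span_pair.2 ⟨1, 0, by module⟩
  have hy : y ∈ Submodule.span K {x, y - c • x} := Submodule.mem_span_pair.2 ⟨c, 1, by module⟩
  rw [IsGeneratingPair, eq_top_iff, ← h]
  exact sup_le_sup_right (Submodule.span_le.2 (Set.pair_subset hx hy)) _

theorem lie_notMem [LieRing.IsNilpotent L] (hL : 1 < nilpotencyLength L L)
    (h : IsGeneratingPair K x y) : ⁅x, y⁆ ∉ 𝒞 2 := by
  intro hxy
  refine not_lowerCentralSeries_le_succ (K := K) hL (lowerCentralSeries_succ_le fun u v _ => ?_)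
  obtain ⟨a, b, d, hd, rfl⟩ := h.exists_eq u
  obtain ⟨a', b', d', hd', rfl⟩ := h.exists_eq v
  have hlie : ⁅a • x + b • y + d, a' • x + b' • y + d'⁆ =
      (a * b' - b * a') • ⁅x, y⁆ + ⁅a • x + b • y + d, d'⁆ - ⁅a' • x + b' • y, d⁆ := by
    simp only [add_lie, lie_add, smul_lie, lie_smul, lie_self, ← lie_skew y x, ← lie_skew x d,
      ← lie_skew y d]
    module
  rw [hlie]
  exact sub_mem (add_mem ((𝒞 2).smul_mem _ hxy) (lie_mem_lowerCentralSeries_succ _ hd'))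
    (lie_mem_lowerCentralSeries_succ _ hd)

theorem exists_of_span_eq_top [FiniteDimensional K L] [LieRing.IsNilpotent L]
    (hfil : nilpotencyLength L L + 1 = finrank K L) (hL : 1 < finrank K L) {S : Set L}
    (hS : Submodule.span K S = ⊤) : ∃ x ∈ S, ∃ y ∈ S, IsGeneratingPair K x y := by
  have hne := span_singleton_sup_lowerCentralSeries_one_ne_top hL
  obtain ⟨x, hxS, hx⟩ := exists_mem_notMem_of_span_eq_top hS (W := (𝒞 1).toSubmodule)
    fun h => hne 0 (by rw [h, sup_top_eq])
  obtain ⟨y, hyS, hy⟩ := exists_mem_notMem_of_span_eq_top hS (hne x)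
  have h₁ := Submodule.finrank_lt_finrank_of_lt (Submodule.covBy_span_singleton_sup hx).lt
  have h₂ := Submodule.finrank_lt_finrank_of_lt (Submodule.covBy_span_singleton_sup hy).lt
  have h₃ : finrank K (𝒞 1).toSubmodule + 1 + 1 = finrank K L :=
    finrank_lowerCentralSeries hfil le_rfl (by omega)
  rw [← sup_assoc, ← Submodule.span_insert] at h₂
  have htop : IsGeneratingPair K y x :=
    Submodule.eq_top_of_finrank_eq (le_antisymm (Submodule.finrank_le _) (by omega))
  exact ⟨x, hxS, y, hyS, htop.symm⟩

variable [FiniteDimensional K L] [LieRing.IsNilpotent L]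
  (hfil : nilpotencyLength L L + 1 = finrank K L)
include hfil

theorem lie_notMem_or_lie_notMem (h : IsGeneratingPair K x y) {k : ℕ} (hk : 1 ≤ k)
    (hkc : k + 1 < nilpotencyLength L L) {v : L} (hv : v ∈ 𝒞 k) (hv' : v ∉ 𝒞 (k + 1)) :
    ⁅x, v⁆ ∉ 𝒞 (k + 2) ∨ ⁅y, v⁆ ∉ 𝒞 (k + 2) := by
  by_contra! hxy
  refine not_lowerCentralSeries_le_succ (K := K) hkc (lowerCentralSeries_succ_le fun l u hu => ?_)
  obtain ⟨c, hc⟩ := exists_sub_smul_mem_lowerCentralSeries_succ hfil hk (by omega) hv hv' hu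
  obtain ⟨a, b, d, hd, rfl⟩ := h.exists_eq l
  have hdv : ⁅d, v⁆ ∈ 𝒞 (k + 2) := by
    have := lie_mem_lowerCentralSeries_add hd hv
    rwa [show 1 + k + 1 = k + 2 by omega] at this
  have hlie : ⁅a • x + b • y + d, u⁆ =
      ⁅a • x + b • y + d, u - c • v⁆ + c • (a • ⁅x, v⁆ + b • ⁅y, v⁆ + ⁅d, v⁆) := by
    simp only [add_lie, smul_lie, lie_sub, lie_smul]
    module
  rw [hlie]
  exact add_mem (lie_mem_lowerCentralSeries_succ _ hc) <| (𝒞 (k + 2)).smul_mem _ <|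
    add_mem (add_mem ((𝒞 (k + 2)).smul_mem a hxy.1) ((𝒞 (k + 2)).smul_mem b hxy.2)) hdv

theorem exists_eigenvector_lie_lie_mem (hL : 2 < nilpotencyLength L L) (D : LieDerivation K L L)
    {p q : K} (h : IsGeneratingPair K x y) (hx : D x = p • x) (hy : D y = q • y)
    (hxxy : ⁅x, ⁅x, y⁆⁆ ∉ 𝒞 3) :
    ∃ y' : L, IsGeneratingPair K x y' ∧ D y' = q • y' ∧ ⁅x, ⁅x, y'⁆⁆ ∉ 𝒞 3 ∧
      ⁅y', ⁅x, y'⁆⁆ ∈ 𝒞 3 := by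
  have hmem (w : L) : ⁅w, ⁅x, y⁆⁆ ∈ 𝒞 2 :=
    lie_mem_lowerCentralSeries_succ w (lie_mem_lowerCentralSeries_one x y)
  obtain ⟨c, hc⟩ := exists_sub_smul_mem_lowerCentralSeries_succ hfil one_le_two hL (hmem x) hxxy
    (hmem y)
  have hDx : D ⁅x, ⁅x, y⁆⁆ = (2 * p + q) • ⁅x, ⁅x, y⁆⁆ := by
    simp only [D.apply_lie_eq_add, hx, hy, smul_lie, lie_smul, lie_add]
    module
  have hDy : D ⁅y, ⁅x, y⁆⁆ = (p + 2 * q) • ⁅y, ⁅x, y⁆⁆ := by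
    simp only [D.apply_lie_eq_add, hx, hy, smul_lie, lie_smul, lie_add]
    module
  have hcpq : c * (2 * p + q - (p + 2 * q)) = 0 :=
    mul_sub_eq_zero_of_sub_smul_mem (f := (D : L →ₗ[K] L)) (W := (𝒞 3).toSubmodule)
      (fun _ => derivation_apply_mem_lowerCentralSeries D) hxxy hDy hDx hc
  have hD : D (y - c • x) = q • (y - c • x) :=
    map_sub_smul_eq_smul_of_mul_sub_eq_zero (f := (D : L →ₗ[K] L)) hy hx
      (by linear_combination hcpq)
  have hlie : ⁅x, y - c • x⁆ = ⁅x, y⁆ := by rw [lie_sub, lie_smul, lie_self, smul_zero, sub_zero]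
  exact ⟨y - c • x, h.sub_smul c, hD, by rwa [hlie], by rwa [hlie, sub_lie, smul_lie]⟩

theorem exists_eigenvectors_lie_lie_mem (hL : 2 < nilpotencyLength L L) (D : LieDerivation K L L)
    {p q : K} (h : IsGeneratingPair K x y) (hx : D x = p • x) (hy : D y = q • y)
    (hp : p ≠ 0) (hq : q ≠ 0) :
    ∃ (x' y' : L) (p' q' : K), p' ≠ 0 ∧ IsGeneratingPair K x' y' ∧ D x' = p' • x' ∧
      D y' = q' • y' ∧ ⁅x', ⁅x', y'⁆⁆ ∉ 𝒞 3 ∧ ⁅y', ⁅x', y'⁆⁆ ∈ 𝒞 3 := by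
  rcases h.lie_notMem_or_lie_notMem hfil le_rfl hL (lie_mem_lowerCentralSeries_one x y)
    (h.lie_notMem (by omega)) with hxxy | hyxy
  · obtain ⟨y', hy'⟩ := h.exists_eigenvector_lie_lie_mem hfil hL D hx hy hxxy
    exact ⟨x, y', p, q, hp, hy'.1, hx, hy'.2⟩
  · have hyyx : ⁅y, ⁅y, x⁆⁆ ∉ 𝒞 3 := by rwa [← lie_skew y x, lie_neg, neg_mem_iff]
    obtain ⟨x', hx'⟩ := h.symm.exists_eigenvector_lie_lie_mem hfil hL D hy hx hyyx
    exact ⟨y, x', q, p, hq, hx'.1, hy, hx'.2⟩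

end IsGeneratingPair

end GeneratingPair

section Expansion

variable {K L : Type*} [Field K] [LieRing L] [LieAlgebra K L] [FiniteDimensional K L]
  [LieRing.IsNilpotent L]

local notation "𝒞" => lowerCentralSeries K L L

theorem exists_eq_sum_smul_of_mem_lowerCentralSeries
    (hfil : nilpotencyLength L L + 1 = finrank K L) {v : ℕ → L} {k : ℕ} (hk : 1 ≤ k)
    (hkc : k ≤ nilpotencyLength L L)
    (hv : ∀ j, k ≤ j → j < nilpotencyLength L L → v j ∈ 𝒞 j ∧ v j ∉ 𝒞 (j + 1))
    {u : L} (hu : u ∈ 𝒞 k) :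
    ∃ a : ℕ → K, u = ∑ j ∈ Finset.Ico k (nilpotencyLength L L), a j • v j := by
  induction hkc using Nat.decreasingInduction generalizing u with
  | self =>
    rw [lowerCentralSeries_nilpotencyLength K L, LieSubmodule.mem_bot] at hu
    exact ⟨0, by simp [hu]⟩
  | of_succ k hkc ih =>
    obtain ⟨hvk, hvk'⟩ := hv k le_rfl hkc
    obtain ⟨c, hc⟩ := exists_sub_smul_mem_lowerCentralSeries_succ hfil hk hkc hvk hvk' hu
    obtain ⟨a, hua⟩ := ih k.succ_pos (fun j hj => hv j (by omega)) hc
    refine ⟨Function.update a k c, ?_⟩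
    rw [Finset.sum_eq_sum_Ico_succ_bot hkc, Function.update_self, ← sub_eq_iff_eq_add', hua]
    refine Finset.sum_congr rfl fun j hj => ?_
    rw [Function.update_of_ne (Nat.ne_of_gt (Finset.mem_Ico.1 hj).1)]

end Expansion

section Chain

variable {K L : Type*} [Field K] [LieRing L] [LieAlgebra K L]

local notation "𝒞" => lowerCentralSeries K L L

variable (K) in
/-- The iterated brackets `z k = (ad x)ᵏ (z 0)` of a generating pair `x`, `z 0` that is chosen, as
in Vergne's adapted bases, so that `x` does not centralize `𝒞 1` modulo `𝒞 3`, but `z 0` does. -/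
structure IsAdaptedChain (x : L) (z : ℕ → L) : Prop where
  isGeneratingPair : IsGeneratingPair K x (z 0)
  lie_eq (k : ℕ) : ⁅x, z k⁆ = z (k + 1)
  two_notMem : z 2 ∉ 𝒞 3
  lie_zero_one_mem : ⁅z 0, z 1⁆ ∈ 𝒞 3

theorem IsGeneratingPair.isAdaptedChain {x y : L} (h : IsGeneratingPair K x y)
    (hx : ⁅x, ⁅x, y⁆⁆ ∉ 𝒞 3) (hy : ⁅y, ⁅x, y⁆⁆ ∈ 𝒞 3) :
    IsAdaptedChain K x fun k => (toEnd K L L x)^[k] y where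
  isGeneratingPair := h
  lie_eq k := (Function.iterate_succ_apply' (toEnd K L L x) k y).symm
  two_notMem := hx
  lie_zero_one_mem := hy

namespace IsAdaptedChain

variable {x : L} {z : ℕ → L}

theorem lie_succ (h : IsAdaptedChain K x z) (i j : ℕ) :
    ⁅z i, z (j + 1)⁆ = ⁅x, ⁅z i, z j⁆⁆ - ⁅z (i + 1), z j⁆ := by
  rw [leibniz_lie x, h.lie_eq, h.lie_eq, add_sub_cancel_left]

theorem mem (h : IsAdaptedChain K x z) (k : ℕ) : z k ∈ 𝒞 k := by
  induction k with
  | zero => exact LieSubmodule.mem_top _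
  | succ k ih =>
    rw [← h.lie_eq]
    exact lie_mem_lowerCentralSeries_succ x ih

theorem apply_eq_smul (h : IsAdaptedChain K x z) (D : LieDerivation K L L) {p q : K}
    (hx : D x = p • x) (hz : D (z 0) = q • z 0) (k : ℕ) : D (z k) = (q + k * p) • z k := by
  induction k with
  | zero => simpa only [Nat.cast_zero, zero_mul, add_zero] using hz
  | succ k ih =>
    rw [← h.lie_eq, D.apply_lie_eq_add, hx, ih, lie_smul, smul_lie, Nat.cast_succ]
    module

theorem lie_zero_two_mem (h : IsAdaptedChain K x z) : ⁅z 0, z 2⁆ ∈ 𝒞 4 := by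
  rw [h.lie_succ, lie_self, sub_zero]
  exact lie_mem_lowerCentralSeries_succ x h.lie_zero_one_mem

theorem lie_zero_three_add_lie_one_two_mem (h : IsAdaptedChain K x z) :
    ⁅z 0, z 3⁆ + ⁅z 1, z 2⁆ ∈ 𝒞 5 := by
  rw [h.lie_succ, sub_add_cancel]
  exact lie_mem_lowerCentralSeries_succ x h.lie_zero_two_mem

theorem lie_zero_lie_zero_three_mem (h : IsAdaptedChain K x z) : ⁅z 0, ⁅z 0, z 3⁆⁆ ∈ 𝒞 6 := by
  have hmem : ⁅z 0, ⁅z 1, z 2⁆⁆ ∈ 𝒞 6 := by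
    rw [leibniz_lie]
    exact add_mem (lie_mem_lowerCentralSeries_add h.lie_zero_one_mem (h.mem 2))
      (lie_mem_lowerCentralSeries_add (h.mem 1) h.lie_zero_two_mem)
  rw [← add_sub_cancel_right ⁅z 0, z 3⁆ ⁅z 1, z 2⁆, lie_sub]
  exact sub_mem (lie_mem_lowerCentralSeries_succ _ h.lie_zero_three_add_lie_one_two_mem) hmem

variable [FiniteDimensional K L] [LieRing.IsNilpotent L]
  (hfil : nilpotencyLength L L + 1 = finrank K L)
include hfil

theorem succ_notMem (h : IsAdaptedChain K x z) {k : ℕ} (hk : 1 ≤ k)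
    (hkc : k + 1 < nilpotencyLength L L) (hzk : z k ∉ 𝒞 (k + 1)) (hlie : ⁅z 0, z k⁆ ∈ 𝒞 (k + 2)) :
    z (k + 1) ∉ 𝒞 (k + 2) := by
  rw [← h.lie_eq]
  exact (h.isGeneratingPair.lie_notMem_or_lie_notMem hfil hk hkc (h.mem k) hzk).resolve_right
    (not_not_intro hlie)

/- If `u = ⁅z 0, z 3⁆` did not lie in `𝒞 5`, it would span `𝒞 4` modulo `𝒞 5`, and `z 0` would
centralize `𝒞 4` modulo `𝒞 6`, as it centralizes `u`. Applying this to `z 4` yields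
`2 • ⁅x, u⁆ ∈ 𝒞 6`, so that the generators `x` and `z 0` both centralize `u` modulo `𝒞 6`. -/
theorem lie_zero_three_mem [NeZero (2 : K)] (hc : 5 < nilpotencyLength L L)
    (h : IsAdaptedChain K x z) : ⁅z 0, z 3⁆ ∈ 𝒞 5 := by
  by_contra hu
  have hu₄ : ⁅z 0, z 3⁆ ∈ 𝒞 4 := lie_mem_lowerCentralSeries_succ (z 0) (h.mem 3)
  obtain ⟨c, hcu⟩ := exists_sub_smul_mem_lowerCentralSeries_succ hfil (by norm_num) (by omega) hu₄
    hu (h.mem 4)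
  have hz₄ : ⁅z 0, z 4⁆ ∈ 𝒞 6 := by
    rw [← sub_add_cancel (z 4) (c • ⁅z 0, z 3⁆), lie_add, lie_smul]
    exact add_mem (lie_mem_lowerCentralSeries_succ _ hcu)
      ((𝒞 6).smul_mem c h.lie_zero_lie_zero_three_mem)
  have hxu : (2 : K) • ⁅x, ⁅z 0, z 3⁆⁆ ∈ 𝒞 6 := by
    have heq : (2 : K) • ⁅x, ⁅z 0, z 3⁆⁆ = ⁅x, ⁅z 0, z 3⁆ + ⁅z 1, z 2⁆⁆ + ⁅z 0, z 4⁆ := by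
      rw [h.lie_succ 0 3, h.lie_succ 1 2, lie_self, lie_add]
      module
    rw [heq]
    exact add_mem (lie_mem_lowerCentralSeries_succ x h.lie_zero_three_add_lie_one_two_mem) hz₄
  rcases h.isGeneratingPair.lie_notMem_or_lie_notMem hfil (by norm_num) (by omega) hu₄ hu with H | H
  · exact H (((𝒞 6).toSubmodule.smul_mem_iff two_ne_zero).1 hxu)
  · exact H h.lie_zero_lie_zero_three_mem

theorem lie_one_two_mem [NeZero (2 : K)] (hc : 5 < nilpotencyLength L L)
    (h : IsAdaptedChain K x z) : ⁅z 1, z 2⁆ ∈ 𝒞 5 := by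
  rw [← add_sub_cancel_left ⁅z 0, z 3⁆ ⁅z 1, z 2⁆]
  exact sub_mem h.lie_zero_three_add_lie_one_two_mem (h.lie_zero_three_mem hfil hc)

theorem lie_zero_four_mem [NeZero (2 : K)] (hc : 5 < nilpotencyLength L L)
    (h : IsAdaptedChain K x z) : ⁅z 0, z 4⁆ ∈ 𝒞 6 := by
  rw [h.lie_succ 0 3, h.lie_succ 1 2, lie_self, sub_zero]
  exact sub_mem (lie_mem_lowerCentralSeries_succ x (h.lie_zero_three_mem hfil hc))
    (lie_mem_lowerCentralSeries_succ x (h.lie_one_two_mem hfil hc))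

theorem notMem_succ [NeZero (2 : K)] (hc : 6 < nilpotencyLength L L)
    (h : IsAdaptedChain K x z) {k : ℕ} (hk : 1 ≤ k) (hk' : k ≤ 5) : z k ∉ 𝒞 (k + 1) := by
  have h₁ : z 1 ∉ 𝒞 2 := h.lie_eq 0 ▸ h.isGeneratingPair.lie_notMem (by omega)
  have h₃ : z 3 ∉ 𝒞 4 :=
    h.succ_notMem hfil one_le_two (by omega) h.two_notMem h.lie_zero_two_mem
  have h₄ : z 4 ∉ 𝒞 5 :=
    h.succ_notMem hfil (by norm_num) (by omega) h₃ (h.lie_zero_three_mem hfil (by omega))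
  have h₅ : z 5 ∉ 𝒞 6 :=
    h.succ_notMem hfil (by norm_num) (by omega) h₄ (h.lie_zero_four_mem hfil (by omega))
  interval_cases k
  exacts [h₁, h.two_notMem, h₃, h₄, h₅]

end IsAdaptedChain

end Chain

section StructureConstants

/-- The structure constants of a family of skew-symmetric bilinear maps on `K⁸` that contains the
brackets of the algebras of the table. The letters `a` and `b` stand for the components of
`⁅e₂, e₃⁆` and `⁅e₃, e₄⁆`, and the number of a component says how far it is above the index of the
last factor: `⁅e₂, e₃⁆ = a2 e₅ + a3 e₆ + a4 e₇ + a5 e₈` and `⁅e₃, e₄⁆ = b2 e₇ + b3 e₈`, while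
`⁅e₁, e₇⁆ = ε e₈` and `⁅e₄, e₅⁆ = η e₈`. -/
@[ext]
structure StructureConstants (K : Type*) where
  ε : K
  η : K
  a2 : K
  b2 : K
  a3 : K
  b3 : K
  a4 : K
  a5 : K

namespace StructureConstants

variable {K : Type*} [Field K]

/-- The skew-symmetric bilinear map with the given structure constants; the coefficients that are
not structure constants are forced by the Jacobi identity for `e₁, eᵢ, eⱼ`. The coordinates are
counted from `0`. -/
def bracket (P : StructureConstants K) (x y : Fin 8 → K) : Fin 8 → K :=
  ![0, 0, x 0 * y 1 - x 1 * y 0, x 0 * y 2 - x 2 * y 0,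
    (x 0 * y 3 - x 3 * y 0) + P.a2 * (x 1 * y 2 - x 2 * y 1),
    (x 0 * y 4 - x 4 * y 0) + P.a2 * (x 1 * y 3 - x 3 * y 1) + P.a3 * (x 1 * y 2 - x 2 * y 1),
    (x 0 * y 5 - x 5 * y 0) + (P.a2 - P.b2) * (x 1 * y 4 - x 4 * y 1)
      + P.b2 * (x 2 * y 3 - x 3 * y 2) + P.a3 * (x 1 * y 3 - x 3 * y 1)
      + P.a4 * (x 1 * y 2 - x 2 * y 1),
    P.ε * (x 0 * y 6 - x 6 * y 0)
      + P.η * ((x 1 * y 6 - x 6 * y 1) - (x 2 * y 5 - x 5 * y 2) + (x 3 * y 4 - x 4 * y 3))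
      + P.ε * (P.a2 - 2 * P.b2) * (x 1 * y 5 - x 5 * y 1)
      + P.ε * P.b2 * (x 2 * y 4 - x 4 * y 2)
      + (P.ε * P.a3 - P.b3) * (x 1 * y 4 - x 4 * y 1) + P.b3 * (x 2 * y 3 - x 3 * y 2)
      + P.ε * P.a4 * (x 1 * y 3 - x 3 * y 1) + P.a5 * (x 1 * y 2 - x 2 * y 1)]

/-- The structure constants that result from multiplying `e₂, …, e₇` by `c` and `e₈` by `d`. -/
def rescale (P : StructureConstants K) (c d : K) : StructureConstants K where
  ε := c * P.ε / d
  η := c ^ 2 * P.η / d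
  a2 := c * P.a2
  b2 := c * P.b2
  a3 := c * P.a3
  b3 := c ^ 2 * P.b3 / d
  a4 := c * P.a4
  a5 := c ^ 2 * P.a5 / d

theorem rescale_self {P : StructureConstants K} (hε : P.ε = 1) {c : K} (hc : c ≠ 0) :
    P.rescale c c =
      ⟨1, c * P.η, c * P.a2, c * P.b2, c * P.a3, c * P.b3, c * P.a4, c * P.a5⟩ := by
  ext <;> simp only [rescale, hε] <;> field_simp

/-- The weights of `e₁, …, e₈` in a gradation in which `e₁` has weight `1` and bracketing with it
leads from `e₂`, of weight `r`, through to `e₇`. -/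
def weights (r ω : K) : Fin 8 → K := ![1, r, r + 1, r + 2, r + 3, r + 4, r + 5, ω]

/-- The diagonal endomorphism with the given weights is a derivation of the bracket. -/
def IsHomogeneous (P : StructureConstants K) (r ω : K) : Prop :=
  ∀ x y, weights r ω * P.bracket x y = P.bracket (weights r ω * x) y + P.bracket x (weights r ω * y)

theorem isHomogeneous_of_mul_eq_zero {P : StructureConstants K} {r ω : K}
    (hε : P.ε * (ω - (r + 6)) = 0) (hη : P.η * (ω - (2 * r + 5)) = 0)
    (ha2 : P.a2 * (r - 2) = 0) (hb2 : P.b2 * (r - 2) = 0) (ha3 : P.a3 * (r - 3) = 0)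
    (hb3 : P.b3 * (ω - (2 * r + 3)) = 0) (ha4 : P.a4 * (r - 4) = 0)
    (ha5 : P.a5 * (ω - (2 * r + 1)) = 0) : P.IsHomogeneous r ω := by
  intro x y
  ext i
  fin_cases i <;>
    simp only [bracket, weights, Pi.mul_apply, Pi.add_apply, Matrix.cons_val, Fin.mk_zero,
      Fin.mk_one, Fin.isValue, Fin.reduceFinMk]
  · ring
  · ring
  · ring
  · ring
  · linear_combination -(x 1 * y 2 - x 2 * y 1) * ha2
  · linear_combination -(x 1 * y 3 - x 3 * y 1) * ha2 - (x 1 * y 2 - x 2 * y 1) * ha3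
  · linear_combination -(x 1 * y 4 - x 4 * y 1) * (ha2 - hb2) - (x 2 * y 3 - x 3 * y 2) * hb2 -
      (x 1 * y 3 - x 3 * y 1) * ha3 - (x 1 * y 2 - x 2 * y 1) * ha4
  · linear_combination (x 0 * y 6 - x 6 * y 0) * hε +
      (x 1 * y 6 - x 6 * y 1 - (x 2 * y 5 - x 5 * y 2) + (x 3 * y 4 - x 4 * y 3)) * hη +
      (x 1 * y 5 - x 5 * y 1) * ((P.a2 - 2 * P.b2) * hε - P.ε * (ha2 - 2 * hb2)) +
      (x 2 * y 4 - x 4 * y 2) * (P.b2 * hε - P.ε * hb2) +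
      (x 1 * y 4 - x 4 * y 1) * (P.a3 * hε - P.ε * ha3 - hb3) +
      (x 2 * y 3 - x 3 * y 2) * hb3 + (x 1 * y 3 - x 3 * y 1) * (P.a4 * hε - P.ε * ha4) +
      (x 1 * y 2 - x 2 * y 1) * ha5

protected theorem IsHomogeneous.mul_eq_zero {P : StructureConstants K} {r ω : K}
    (h : P.IsHomogeneous r ω) :
    P.ε * (ω - (r + 6)) = 0 ∧ P.η * (ω - (2 * r + 5)) = 0 ∧
    P.a2 * (r - 2) = 0 ∧ P.b2 * (r - 2) = 0 ∧ P.a3 * (r - 3) = 0 ∧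
    P.b3 * (ω - (2 * r + 3)) = 0 ∧ P.a4 * (r - 4) = 0 ∧ P.a5 * (ω - (2 * r + 1)) = 0 := by
  have h₀ := congrFun (h (Pi.single 0 1) (Pi.single 6 1)) 7
  have h₁ (i : Fin 8) := congrFun (h (Pi.single 1 1) (Pi.single 2 1)) i
  have h₂ (i : Fin 8) := congrFun (h (Pi.single 2 1) (Pi.single 3 1)) i
  have h₃ := congrFun (h (Pi.single 3 1) (Pi.single 4 1)) 7
  have h₁₄ := h₁ 4
  have h₁₅ := h₁ 5
  have h₁₆ := h₁ 6
  have h₁₇ := h₁ 7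
  have h₂₆ := h₂ 6
  have h₂₇ := h₂ 7
  simp only [bracket, weights, Pi.mul_apply, Pi.add_apply, Pi.single_apply, Matrix.cons_val,
    Fin.reduceEq, if_true, if_false] at h₀ h₁₄ h₁₅ h₁₆ h₁₇ h₂₆ h₂₇ h₃
  refine ⟨?_, ?_, ?_, ?_, ?_, ?_, ?_, ?_⟩
  · linear_combination h₀
  · linear_combination h₃
  · linear_combination -h₁₄
  · linear_combination -h₂₆
  · linear_combination -h₁₅
  · linear_combination h₂₇
  · linear_combination -h₁₆
  · linear_combination h₁₇

end StructureConstants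

end StructureConstants

section AdaptedFamily

variable {K L : Type*} [Field K] [LieRing L] [LieAlgebra K L]

/-- Coordinates on a Lie algebra in which its bracket is the one with the structure constants
`P`. -/
def IsAdapted (φ : L ≃ₗ[K] (Fin 8 → K)) (P : StructureConstants K) : Prop :=
  ∀ x y, φ ⁅x, y⁆ = P.bracket (φ x) (φ y)

/-- A family of elements of a Lie algebra that satisfies enough of the relations of the bracket with
the structure constants `P` to satisfy all of them. -/
structure IsAdaptedFamily (f : Fin 8 → L) (P : StructureConstants K) : Prop where
  lie_zero_one : ⁅f 0, f 1⁆ = f 2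
  lie_zero_two : ⁅f 0, f 2⁆ = f 3
  lie_zero_three : ⁅f 0, f 3⁆ = f 4
  lie_zero_four : ⁅f 0, f 4⁆ = f 5
  lie_zero_five : ⁅f 0, f 5⁆ = f 6
  lie_zero_six : ⁅f 0, f 6⁆ = P.ε • f 7
  lie_zero_seven : ⁅f 0, f 7⁆ = 0
  lie_one_two : ⁅f 1, f 2⁆ = P.a2 • f 4 + P.a3 • f 5 + P.a4 • f 6 + P.a5 • f 7
  lie_two_three : ⁅f 2, f 3⁆ = P.b2 • f 6 + P.b3 • f 7
  lie_three_four : ⁅f 3, f 4⁆ = P.η • f 7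
  lie_eq_zero {i j : Fin 8} (h : 8 ≤ i.val + j.val) : ⁅f i, f j⁆ = 0

namespace IsAdaptedFamily

variable {f : Fin 8 → L} {P : StructureConstants K}

theorem lie_one_three (h : IsAdaptedFamily f P) :
    ⁅f 1, f 3⁆ = P.a2 • f 5 + P.a3 • f 6 + (P.ε * P.a4) • f 7 := by
  have hjac := leibniz_lie (f 0) (f 1) (f 2)
  simp only [h.lie_zero_one, h.lie_zero_two, h.lie_zero_four, h.lie_zero_five, h.lie_zero_six,
    h.lie_zero_seven, h.lie_one_two, lie_self, lie_add, lie_smul, zero_add] at hjac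
  rw [← hjac]
  module

theorem lie_one_four (h : IsAdaptedFamily f P) :
    ⁅f 1, f 4⁆ = (P.a2 - P.b2) • f 6 + (P.ε * P.a3 - P.b3) • f 7 := by
  have hjac := leibniz_lie (f 0) (f 1) (f 3)
  simp only [h.lie_zero_one, h.lie_zero_three, h.lie_zero_five, h.lie_zero_six, h.lie_zero_seven,
    h.lie_one_three, h.lie_two_three, lie_add, lie_smul] at hjac
  rw [← sub_eq_iff_eq_add'.2 hjac]
  module

theorem lie_two_four (h : IsAdaptedFamily f P) : ⁅f 2, f 4⁆ = (P.ε * P.b2) • f 7 := by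
  have hjac := leibniz_lie (f 0) (f 2) (f 3)
  simp only [h.lie_zero_two, h.lie_zero_three, h.lie_zero_six, h.lie_zero_seven, h.lie_two_three,
    lie_self, lie_add, lie_smul, zero_add] at hjac
  rw [← hjac]
  module

theorem lie_one_five (h : IsAdaptedFamily f P) :
    ⁅f 1, f 5⁆ = (P.ε * (P.a2 - 2 * P.b2)) • f 7 := by
  have hjac := leibniz_lie (f 0) (f 1) (f 4)
  simp only [h.lie_zero_one, h.lie_zero_four, h.lie_zero_six, h.lie_zero_seven, h.lie_one_four,
    h.lie_two_four, lie_add, lie_smul] at hjac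
  rw [← sub_eq_iff_eq_add'.2 hjac]
  module

theorem lie_two_five (h : IsAdaptedFamily f P) : ⁅f 2, f 5⁆ = (-P.η) • f 7 := by
  have hjac := leibniz_lie (f 0) (f 2) (f 4)
  simp only [h.lie_zero_two, h.lie_zero_four, h.lie_zero_seven, h.lie_two_four, h.lie_three_four,
    lie_smul] at hjac
  rw [← sub_eq_iff_eq_add'.2 hjac]
  module

theorem lie_one_six (h : IsAdaptedFamily f P) : ⁅f 1, f 6⁆ = P.η • f 7 := by
  have hjac := leibniz_lie (f 0) (f 1) (f 5)
  simp only [h.lie_zero_one, h.lie_zero_five, h.lie_zero_seven, h.lie_one_five, h.lie_two_five,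
    lie_smul] at hjac
  rw [← sub_eq_iff_eq_add'.2 hjac]
  module

theorem lie_sum_smul_sum_smul (h : IsAdaptedFamily f P) (x y : Fin 8 → K) :
    ⁅∑ i, x i • f i, ∑ i, y i • f i⁆ = ∑ i, P.bracket x y i • f i := by
  have swap {i j : Fin 8} {v : L} (hv : ⁅f i, f j⁆ = v) : ⁅f j, f i⁆ = -v := by rw [← lie_skew, hv]
  simp only [Fin.sum_univ_eight, lie_add, add_lie, smul_lie, lie_smul, lie_self,
    h.lie_zero_one, h.lie_zero_two, h.lie_zero_three, h.lie_zero_four, h.lie_zero_five,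
    h.lie_zero_six, h.lie_zero_seven, h.lie_one_two, h.lie_one_three, h.lie_one_four,
    h.lie_one_five, h.lie_one_six, h.lie_two_three, h.lie_two_four, h.lie_two_five,
    h.lie_three_four,
    swap h.lie_zero_one, swap h.lie_zero_two, swap h.lie_zero_three, swap h.lie_zero_four,
    swap h.lie_zero_five, swap h.lie_zero_six, swap h.lie_zero_seven, swap h.lie_one_two,
    swap h.lie_one_three, swap h.lie_one_four, swap h.lie_one_five, swap h.lie_one_six,
    swap h.lie_two_three, swap h.lie_two_four, swap h.lie_two_five, swap h.lie_three_four,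
    h.lie_eq_zero, Fin.isValue, Fin.coe_ofNat_eq_mod, Nat.reduceMod, Nat.reduceAdd,
    Nat.reduceLeDiff, StructureConstants.bracket, Matrix.cons_val]
  module

theorem isAdapted_equivFun {B : Basis (Fin 8) K L} (h : IsAdaptedFamily B P) :
    IsAdapted B.equivFun P := by
  intro x y
  conv_lhs => rw [← B.sum_equivFun x, ← B.sum_equivFun y, h.lie_sum_smul_sum_smul]
  exact (LinearEquiv.eq_symm_apply _).1 (B.equivFun_symm_apply _).symm

end IsAdaptedFamily

end AdaptedFamily

section AdaptedCoordinates

variable {K L : Type*} [Field K] [LieRing L] [LieAlgebra K L]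

local notation "𝒞" => lowerCentralSeries K L L

theorem IsAdapted.isHomogeneous {φ : L ≃ₗ[K] (Fin 8 → K)} {P : StructureConstants K}
    (hφ : IsAdapted φ P) (D : LieDerivation K L L) {r ω : K}
    (hD : ∀ u, φ (D u) = StructureConstants.weights r ω * φ u) : P.IsHomogeneous r ω := by
  intro x y
  have h := congrArg φ (D.apply_lie_eq_add (φ.symm x) (φ.symm y))
  rw [map_add, hD, hφ, hφ, hφ, hD, hD, φ.apply_symm_apply, φ.apply_symm_apply] at h
  rw [h, add_comm]

namespace IsAdaptedChain

variable [NeZero (2 : K)] [FiniteDimensional K L] [LieRing.IsNilpotent L]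
  {x e : L} {z : ℕ → L}

theorem exists_eq_sum_smul (h : IsAdaptedChain K x z)
    (hfil : nilpotencyLength L L + 1 = finrank K L) (hL : finrank K L = 8)
    (he : e ∈ 𝒞 6) (he0 : e ≠ 0) {k : ℕ} (hk : 1 ≤ k) (hk' : k ≤ 7) {u : L} (hu : u ∈ 𝒞 k) :
    ∃ a : ℕ → K, u = ∑ j ∈ Finset.Ico k 7, a j • Function.update z 6 e j := by
  have hc : nilpotencyLength L L = 7 := by omega
  have hbot : 𝒞 7 = ⊥ := hc ▸ lowerCentralSeries_nilpotencyLength K L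
  have hv (j : ℕ) (hj : k ≤ j) (hjc : j < nilpotencyLength L L) :
      Function.update z 6 e j ∈ 𝒞 j ∧ Function.update z 6 e j ∉ 𝒞 (j + 1) := by
    rcases eq_or_ne j 6 with rfl | hj6
    · rw [Function.update_self, hbot, LieSubmodule.mem_bot]
      exact ⟨he, he0⟩
    · rw [Function.update_of_ne hj6]
      exact ⟨h.mem j, h.notMem_succ hfil (by omega) (by omega) (by omega)⟩
  rw [← hc] at hk' ⊢
  exact exists_eq_sum_smul_of_mem_lowerCentralSeries hfil hk hk' hv hu

theorem span_eq_top (h : IsAdaptedChain K x z) (hfil : nilpotencyLength L L + 1 = finrank K L)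
    (hL : finrank K L = 8) (he : e ∈ 𝒞 6) (he0 : e ≠ 0) :
    Submodule.span K (Set.range ![x, z 0, z 1, z 2, z 3, z 4, z 5, e]) = ⊤ := by
  refine Submodule.eq_top_iff'.2 fun u => ?_
  obtain ⟨a, b, d, hd, rfl⟩ := h.isGeneratingPair.exists_eq u
  obtain ⟨c, rfl⟩ := h.exists_eq_sum_smul hfil hL he he0 le_rfl (by norm_num) hd
  refine (Submodule.mem_span_range_iff_exists_fun K).2 ⟨![a, b, c 1, c 2, c 3, c 4, c 5, c 6], ?_⟩
  simp only [Fin.sum_univ_eight, Matrix.cons_val, Finset.sum_Ico_succ_top, Nat.one_le_ofNat,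
    Nat.Ico_succ_singleton, Finset.sum_singleton, ne_eq, OfNat.one_ne_ofNat, Nat.reduceEqDiff,
    not_false_eq_true, Function.update_of_ne, Function.update_self]
  module

theorem exists_isAdaptedFamily (h : IsAdaptedChain K x z)
    (hfil : nilpotencyLength L L + 1 = finrank K L) (hL : finrank K L = 8)
    (he : e ∈ 𝒞 6) (he0 : e ≠ 0) {ε : K} (hε : ⁅x, z 5⁆ = ε • e) :
    ∃ P : StructureConstants K,
      P.ε = ε ∧ IsAdaptedFamily ![x, z 0, z 1, z 2, z 3, z 4, z 5, e] P := by
  have hc : nilpotencyLength L L = 7 := by omega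
  have hbot : 𝒞 7 = ⊥ := hc ▸ lowerCentralSeries_nilpotencyLength K L
  have heq_zero {k : ℕ} (hk : 7 ≤ k) {u : L} (hu : u ∈ 𝒞 k) : u = 0 := by
    simpa only [hbot, LieSubmodule.mem_bot] using antitone_lowerCentralSeries K L L hk hu
  obtain ⟨a, ha⟩ := h.exists_eq_sum_smul hfil hL he he0 (by norm_num) (by norm_num)
    h.lie_zero_one_mem
  obtain ⟨b, hb⟩ := h.exists_eq_sum_smul hfil hL he he0 (by norm_num) (by norm_num)
    (h.lie_one_two_mem hfil (by omega))
  obtain ⟨η, hη⟩ := h.exists_eq_sum_smul hfil hL he he0 (by norm_num) (by norm_num)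
    (lie_mem_lowerCentralSeries_add (h.mem 2) (h.mem 3))
  simp only [Finset.sum_Ico_succ_top, Nat.reduceLeDiff, Nat.Ico_succ_singleton, Nat.reduceAdd,
    Finset.sum_singleton, ne_eq, Nat.reduceEqDiff, not_false_eq_true, Function.update_of_ne,
    Function.update_self] at ha hb hη
  refine ⟨⟨ε, η 6, a 3, b 5, a 4, b 6, a 5, a 6⟩, rfl,
    h.lie_eq 0, h.lie_eq 1, h.lie_eq 2, h.lie_eq 3, h.lie_eq 4, hε,
    heq_zero le_rfl (lie_mem_lowerCentralSeries_succ x he), ha, hb, hη, ?_⟩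
  have hmem (i : Fin 8) : (![x, z 0, z 1, z 2, z 3, z 4, z 5, e] i : L) ∈ 𝒞 (i - 1) := by
    fin_cases i
    exacts [LieSubmodule.mem_top x, h.mem 0, h.mem 1, h.mem 2, h.mem 3, h.mem 4, h.mem 5, he]
  intro i j hij
  exact heq_zero (by omega) (lie_mem_lowerCentralSeries_add (hmem i) (hmem j))

theorem exists_isAdapted (h : IsAdaptedChain K x z)
    (hfil : nilpotencyLength L L + 1 = finrank K L) (hL : finrank K L = 8)
    (D : LieDerivation K L L) {r ω : K} (hx : D x = x) (hz : D (z 0) = r • z 0)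
    (he : e ∈ 𝒞 6) (he0 : e ≠ 0) (hDe : D e = ω • e) {ε : K} (hε : ⁅x, z 5⁆ = ε • e) :
    ∃ (φ : L ≃ₗ[K] (Fin 8 → K)) (P : StructureConstants K),
      IsAdapted φ P ∧ P.IsHomogeneous r ω ∧ P.ε = ε ∧ ⁅z 0, z 5⁆ = P.η • e := by
  obtain ⟨P, hPε, hP⟩ := h.exists_isAdaptedFamily hfil hL he he0 hε
  let B := basisOfTopLeSpanOfCardEqFinrank ![x, z 0, z 1, z 2, z 3, z 4, z 5, e]
    (h.span_eq_top hfil hL he he0).ge (by rw [hL, Fintype.card_fin])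
  have hB : ⇑B = ![x, z 0, z 1, z 2, z 3, z 4, z 5, e] :=
    coe_basisOfTopLeSpanOfCardEqFinrank _ _ _
  have hφ : IsAdapted B.equivFun P := IsAdaptedFamily.isAdapted_equivFun (hB ▸ hP)
  have hDz (k : ℕ) : D (z k) = (r + k) • z k := by
    simpa only [mul_one] using h.apply_eq_smul D (p := 1) (by rw [hx, one_smul]) hz k
  have hDz₁ : D (z 1) = (r + 1) • z 1 := by simpa only [Nat.cast_one] using hDz 1
  have hDB (i : Fin 8) : (D : L →ₗ[K] L) (B i) = StructureConstants.weights r ω i • B i := by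
    rw [hB]
    fin_cases i
    exacts [hx.trans (one_smul K x).symm, hz, hDz₁, hDz 2, hDz 3, hDz 4, hDz 5, hDe]
  exact ⟨B.equivFun, P, hφ, hφ.isHomogeneous D (equivFun_apply_eq_mul B hDB), hPε, hP.lie_one_six⟩

theorem exists_isAdapted_or (h : IsAdaptedChain K x z)
    (hfil : nilpotencyLength L L + 1 = finrank K L) (hL : finrank K L = 8)
    (D : LieDerivation K L L) {r : K} (hx : D x = x) (hz : D (z 0) = r • z 0) :
    ∃ (φ : L ≃ₗ[K] (Fin 8 → K)) (P : StructureConstants K) (ω : K),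
      IsAdapted φ P ∧ P.IsHomogeneous r ω ∧ (P.ε = 1 ∨ P.ε = 0 ∧ P.η = -1) := by
  have hD₅ : D (z 5) = (r + 5) • z 5 := by
    simpa using h.apply_eq_smul D (p := 1) (by rw [hx, one_smul]) hz 5
  by_cases hx₅ : ⁅x, z 5⁆ = 0
  · have hz₅ : ⁅z 0, z 5⁆ ≠ 0 := fun hz₅ => by
      have hlie := h.isGeneratingPair.lie_notMem_or_lie_notMem hfil (k := 5) (by norm_num)
        (by omega) (h.mem 5) (h.notMem_succ hfil (by omega) (by norm_num) le_rfl)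
      rw [hx₅, hz₅] at hlie
      exact hlie.elim (· (zero_mem _)) (· (zero_mem _))
    have hDe : D (-⁅z 0, z 5⁆) = (2 * r + 5) • -⁅z 0, z 5⁆ := by
      rw [map_neg, D.apply_lie_eq_add, hz, hD₅, lie_smul, smul_lie]
      module
    obtain ⟨φ, P, hφ, hP, hε, hη⟩ := h.exists_isAdapted hfil hL D hx hz
      (neg_mem (lie_mem_lowerCentralSeries_succ _ (h.mem 5))) (neg_ne_zero.2 hz₅) hDe
      (hx₅.trans (zero_smul K _).symm)
    rw [smul_neg, ← neg_smul] at hη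
    have hη' : -P.η = 1 := smul_left_injective K hz₅ (hη.symm.trans (one_smul K _).symm)
    exact ⟨φ, P, 2 * r + 5, hφ, hP, Or.inr ⟨hε, neg_eq_iff_eq_neg.1 hη'⟩⟩
  · have hDe : D ⁅x, z 5⁆ = (r + 6) • ⁅x, z 5⁆ := by
      rw [D.apply_lie_eq_add, hx, hD₅, lie_smul]
      module
    obtain ⟨φ, P, hφ, hP, hε, -⟩ := h.exists_isAdapted hfil hL D hx hz
      (lie_mem_lowerCentralSeries_succ x (h.mem 5)) hx₅ hDe (one_smul K _).symm
    exact ⟨φ, P, r + 6, hφ, hP, Or.inl hε⟩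

end IsAdaptedChain

theorem IsGeneratingPair.exists_isAdapted [NeZero (2 : K)] [FiniteDimensional K L]
    [LieRing.IsNilpotent L] (hfil : nilpotencyLength L L + 1 = finrank K L)
    (hL : finrank K L = 8) (D : LieDerivation K L L) {x y : L} {p q : K}
    (h : IsGeneratingPair K x y) (hx : D x = p • x) (hy : D y = q • y) (hp : p ≠ 0) (hq : q ≠ 0) :
    ∃ (φ : L ≃ₗ[K] (Fin 8 → K)) (P : StructureConstants K) (r ω : K),
      IsAdapted φ P ∧ P.IsHomogeneous r ω ∧ (P.ε = 1 ∨ P.ε = 0 ∧ P.η = -1) := by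
  obtain ⟨x', y', p', q', hp', hxy', hx', hy', hxxy, hyxy⟩ :=
    h.exists_eigenvectors_lie_lie_mem hfil (by omega) D hx hy hp hq
  obtain ⟨φ, P, ω, hP⟩ := (hxy'.isAdaptedChain hxxy hyxy).exists_isAdapted_or hfil hL (p'⁻¹ • D)
    (r := p'⁻¹ * q') (by rw [LieDerivation.smul_apply, hx', inv_smul_smul₀ hp'])
    (by rw [Function.iterate_zero_apply, LieDerivation.smul_apply, hy', smul_smul])
  exact ⟨φ, P, p'⁻¹ * q', ω, hP⟩

end AdaptedCoordinates

section Normalization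

namespace IsAdapted

variable {K L L' : Type*} [Field K] [LieRing L] [LieAlgebra K L] [LieRing L'] [LieAlgebra K L']
  {φ : L ≃ₗ[K] (Fin 8 → K)} {P : StructureConstants K}

/-- The isomorphism of Lie algebras with the same structure constants that identifies the
coordinates. -/
def lieEquiv (hφ : IsAdapted φ P) {ψ : L' ≃ₗ[K] (Fin 8 → K)} (hψ : IsAdapted ψ P) :
    L ≃ₗ⁅K⁆ L' where
  __ := φ ≪≫ₗ ψ.symm
  map_lie' {x y} := ψ.injective <| by simp [hφ x y, hψ _ _]

theorem comp_lieEquiv (hφ : IsAdapted φ P) (e : L' ≃ₗ⁅K⁆ L) :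
    IsAdapted (e.toLinearEquiv ≪≫ₗ φ) P := fun x y =>
  (congrArg φ (e.map_lie x y)).trans (hφ _ _)

theorem trans_symm (hφ : IsAdapted φ P) {Q : StructureConstants K}
    {T : (Fin 8 → K) ≃ₗ[K] (Fin 8 → K)}
    (hT : ∀ x y, T (Q.bracket x y) = P.bracket (T x) (T y)) : IsAdapted (φ ≪≫ₗ T.symm) Q :=
  fun x y => T.injective <| by simp [hφ x y, hT]

theorem exists_isAdapted_rescale (hφ : IsAdapted φ P) {c d : K} (hc : c ≠ 0) (hd : d ≠ 0) :
    ∃ ψ : L ≃ₗ[K] (Fin 8 → K), IsAdapted ψ (P.rescale c d) := by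
  let T : (Fin 8 → K) ≃ₗ[K] (Fin 8 → K) := .piCongrRight fun i =>
    LinearEquiv.smulOfNeZero K K (![1, c, c, c, c, c, c, d] i) (by fin_cases i <;> simp [hc, hd])
  refine ⟨_, hφ.trans_symm (T := T) fun x y => ?_⟩
  ext i
  fin_cases i <;> simp [T, StructureConstants.bracket, StructureConstants.rescale] <;> field_simp

theorem η_mul_eq_zero (hφ : IsAdapted φ P) : P.η * (P.b2 + 2 * P.a2) = 0 := by
  have h := congrArg φ (leibniz_lie (φ.symm (Pi.single 1 1)) (φ.symm (Pi.single 2 1))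
    (φ.symm (Pi.single 3 1)))
  simp only [map_add, hφ _ _, φ.apply_symm_apply] at h
  have h₇ := congrFun h 7
  simp only [StructureConstants.bracket, Pi.add_apply, Pi.single_apply, Matrix.cons_val,
    Fin.reduceEq, if_true, if_false] at h₇
  linear_combination h₇

end IsAdapted

end Normalization

section Table

/-- The structure constants of the algebras of the table. -/
noncomputable def TableName.params : TableName → StructureConstants ℝ
  | .m0 => ⟨1, 0, 0, 0, 0, 0, 0, 0⟩
  | .m1 => ⟨1, 1, 0, 0, 0, 0, 0, 0⟩
  | .m2 => ⟨1, 0, 1, 0, 0, 0, 0, 0⟩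
  | .g α => ⟨1, 0, 2 + α, 1, 0, 0, 0, 0⟩
  | .a t => ⟨1, 0, 0, 0, t + 1, 1, 0, 0⟩
  | .c10 => ⟨1, 0, 0, 0, 1, 0, 0, 0⟩
  | .d1 => ⟨1, 0, 0, 0, 0, 0, 1, 0⟩
  | .h1 => ⟨1, 0, 0, 0, 0, 0, 0, 1⟩
  | .b => ⟨0, -1, -1 / 2, 1, 0, 0, 0, 0⟩
  | .k1 => ⟨0, -1, 0, 0, 1, 0, 0, 0⟩
  | .s1 => ⟨0, -1, 0, 0, 0, 0, 1, 0⟩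

theorem mu_relations (s : TableName) (x y : Fin 8 → ℝ) :
    mu (relations s) x y = s.params.bracket x y := by
  ext m
  cases s <;> fin_cases m <;>
    simp [relations, chain7, chain6, mu_cons, mu_nil, pos, Fin.ofNat, TableName.params,
      StructureConstants.bracket] <;> ring

/-- The standard coordinates on an algebra of the table. -/
noncomputable def TableAlgebra.coords (s : TableName) : TableAlgebra s ≃ₗ[ℝ] (Fin 8 → ℝ) :=
  LinearEquiv.refl ℝ (Fin 8 → ℝ)

theorem isAdapted_coords (s : TableName) : IsAdapted (TableAlgebra.coords s) s.params :=
  mu_relations s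

theorem finrank_tableAlgebra (s : TableName) : finrank ℝ (TableAlgebra s) = 8 := by
  rw [(TableAlgebra.coords s).finrank_eq, finrank_fin_fun]

namespace StructureConstants

variable {P : StructureConstants ℝ} {r ω : ℝ}

theorem IsHomogeneous.exists_rescale_eq_params_of_ε_eq_one (hP : P.IsHomogeneous r ω)
    (hε : P.ε = 1) : ∃ (s : TableName) (c : ℝ), c ≠ 0 ∧ P.rescale c c = s.params := by
  obtain ⟨hω, hη, ha2, hb2, ha3, hb3, ha4, ha5⟩ := hP.mul_eq_zero
  obtain rfl : ω = r + 6 := by linear_combination hω - (ω - (r + 6)) * hε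
  suffices h : ∃ (s : TableName) (c : ℝ), c ≠ 0 ∧
      (⟨1, c * P.η, c * P.a2, c * P.b2, c * P.a3, c * P.b3, c * P.a4, c * P.a5⟩ :
        StructureConstants ℝ) = s.params by
    obtain ⟨s, c, hc, hs⟩ := h
    exact ⟨s, c, hc, (rescale_self hε hc).trans hs⟩
  replace hη : P.η * (r - 1) = 0 := by linear_combination -hη
  replace hb3 : P.b3 * (r - 3) = 0 := by linear_combination -hb3
  replace ha5 : P.a5 * (r - 5) = 0 := by linear_combination -ha5
  by_cases hη₀ : P.η = 0; swap
  · obtain rfl := eq_of_mul_sub_eq_zero hη hη₀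
    norm_num at ha2 hb2 ha3 hb3 ha4 ha5
    exact ⟨.m1, P.η⁻¹, inv_ne_zero hη₀, by simp [TableName.params, *]⟩
  by_cases hb2₀ : P.b2 = 0; swap
  · obtain rfl := eq_of_mul_sub_eq_zero hb2 hb2₀
    norm_num at ha3 hb3 ha4 ha5
    exact ⟨.g (P.b2⁻¹ * P.a2 - 2), P.b2⁻¹, inv_ne_zero hb2₀, by simp [TableName.params, *]⟩
  by_cases ha2₀ : P.a2 = 0; swap
  · obtain rfl := eq_of_mul_sub_eq_zero ha2 ha2₀
    norm_num at ha3 hb3 ha4 ha5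
    exact ⟨.m2, P.a2⁻¹, inv_ne_zero ha2₀, by simp [TableName.params, *]⟩
  by_cases hb3₀ : P.b3 = 0; swap
  · obtain rfl := eq_of_mul_sub_eq_zero hb3 hb3₀
    norm_num at ha4 ha5
    exact ⟨.a (P.b3⁻¹ * P.a3 - 1), P.b3⁻¹, inv_ne_zero hb3₀, by simp [TableName.params, *]⟩
  by_cases ha3₀ : P.a3 = 0; swap
  · obtain rfl := eq_of_mul_sub_eq_zero ha3 ha3₀
    norm_num at ha4 ha5
    exact ⟨.c10, P.a3⁻¹, inv_ne_zero ha3₀, by simp [TableName.params, *]⟩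
  by_cases ha4₀ : P.a4 = 0; swap
  · obtain rfl := eq_of_mul_sub_eq_zero ha4 ha4₀
    norm_num at ha5
    exact ⟨.d1, P.a4⁻¹, inv_ne_zero ha4₀, by simp [TableName.params, *]⟩
  by_cases ha5₀ : P.a5 = 0; swap
  · exact ⟨.h1, P.a5⁻¹, inv_ne_zero ha5₀, by simp [TableName.params, *]⟩
  exact ⟨.m0, 1, one_ne_zero, by simp [TableName.params, *]⟩

theorem IsHomogeneous.exists_rescale_eq_params_of_ε_eq_zero (hP : P.IsHomogeneous r ω)
    (hε : P.ε = 0) (hη : P.η = -1) (hb2 : P.b2 = -2 * P.a2) (hm1 : P ≠ ⟨0, -1, 0, 0, 0, 0, 0, 0⟩) :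
    ∃ (s : TableName) (c : ℝ), c ≠ 0 ∧ P.rescale c (c ^ 2) = s.params := by
  obtain ⟨-, hω, ha2, -, ha3, hb3, ha4, ha5⟩ := hP.mul_eq_zero
  obtain rfl : ω = 2 * r + 5 := by linear_combination -hω + (ω - (2 * r + 5)) * hη
  norm_num at hb3 ha5
  have rescale_eq {c : ℝ} (hc : c ≠ 0) : P.rescale c (c ^ 2) =
      ⟨0, -1, c * P.a2, -2 * (c * P.a2), c * P.a3, 0, c * P.a4, 0⟩ := by
    ext <;> simp only [rescale, hε, hη, hb2, hb3, ha5, mul_zero, zero_div] <;> field_simp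
  by_cases ha2₀ : P.a2 = 0; swap
  · obtain rfl := eq_of_mul_sub_eq_zero ha2 ha2₀
    norm_num at ha3 ha4
    have hc : -1 / 2 * P.a2⁻¹ ≠ 0 := mul_ne_zero (by norm_num) (inv_ne_zero ha2₀)
    exact ⟨.b, _, hc, by rw [rescale_eq hc]; norm_num [TableName.params, *]⟩
  by_cases ha3₀ : P.a3 = 0; swap
  · obtain rfl := eq_of_mul_sub_eq_zero ha3 ha3₀
    norm_num at ha4
    have hc : P.a3⁻¹ ≠ 0 := inv_ne_zero ha3₀
    exact ⟨.k1, _, hc, by rw [rescale_eq hc]; simp [TableName.params, *]⟩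
  by_cases ha4₀ : P.a4 = 0; swap
  · have hc : P.a4⁻¹ ≠ 0 := inv_ne_zero ha4₀
    exact ⟨.s1, _, hc, by rw [rescale_eq hc]; simp [TableName.params, *]⟩
  · refine absurd ?_ hm1
    ext <;> simp [*]

end StructureConstants

namespace IsAdapted

variable {L : Type*} [LieRing L] [LieAlgebra ℝ L] {φ : L ≃ₗ[ℝ] (Fin 8 → ℝ)}

theorem exists_isAdapted_m1 (hφ : IsAdapted φ ⟨0, -1, 0, 0, 0, 0, 0, 0⟩) :
    ∃ ψ : L ≃ₗ[ℝ] (Fin 8 → ℝ), IsAdapted ψ TableName.m1.params := by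
  let f : (Fin 8 → ℝ) →ₗ[ℝ] (Fin 8 → ℝ) :=
    { toFun u := ![u 0, -u 0 - u 1, -u 2, -u 3, -u 4, -u 5, -u 6, -u 7]
      map_add' u v := by ext i; fin_cases i <;> simp <;> ring
      map_smul' c u := by ext i; fin_cases i <;> simp; ring }
  have hf : Function.Involutive f := fun u => by ext i; fin_cases i <;> simp [f]
  refine ⟨_, hφ.trans_symm (T := .ofInvolutive f hf) fun x y => ?_⟩
  ext i
  fin_cases i <;> simp [f, StructureConstants.bracket, TableName.params] <;> ring

theorem exists_isAdapted_params {P : StructureConstants ℝ} (hφ : IsAdapted φ P) {r ω : ℝ}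
    (hP : P.IsHomogeneous r ω) (h : P.ε = 1 ∨ P.ε = 0 ∧ P.η = -1) :
    ∃ (s : TableName) (ψ : L ≃ₗ[ℝ] (Fin 8 → ℝ)), IsAdapted ψ s.params := by
  rcases h with hε | ⟨hε, hη⟩
  · obtain ⟨s, c, hc, hs⟩ := hP.exists_rescale_eq_params_of_ε_eq_one hε
    exact ⟨s, hs ▸ hφ.exists_isAdapted_rescale hc hc⟩
  · rcases eq_or_ne P ⟨0, -1, 0, 0, 0, 0, 0, 0⟩ with rfl | hm1
    · exact ⟨.m1, hφ.exists_isAdapted_m1⟩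
    · have hb2 : P.b2 = -2 * P.a2 := by
        linear_combination -hφ.η_mul_eq_zero + (P.b2 + 2 * P.a2) * hη
      obtain ⟨s, c, hc, hs⟩ := hP.exists_rescale_eq_params_of_ε_eq_zero hε hη hb2 hm1
      exact ⟨s, hs ▸ hφ.exists_isAdapted_rescale hc (pow_ne_zero 2 hc)⟩

end IsAdapted

end Table

section Triangular

variable {K L : Type*} [Field K] [LieRing L] [LieAlgebra K L]

local notation "𝒞" => lowerCentralSeries K L L

theorem StructureConstants.bracket_apply_eq_zero (P : StructureConstants K) (x : Fin 8 → K)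
    {y : Fin 8 → K} {i : Fin 8} (h : ∀ j < i, y j = 0) : P.bracket x y i = 0 := by
  fin_cases i <;> simp [bracket, h]

theorem StructureConstants.bracket_eq_zero (P : StructureConstants K) {x y : Fin 8 → K}
    (h : ∀ i j : Fin 8, i.val + j.val < 8 → x i * y j = 0) : P.bracket x y = 0 := by
  ext i
  fin_cases i <;> simp [bracket, h]

theorem IsAdapted.apply_eq_zero_of_mem_lowerCentralSeries {φ : L ≃ₗ[K] (Fin 8 → K)}
    {P : StructureConstants K} (hφ : IsAdapted φ P) {k : ℕ} {x : L} (hx : x ∈ 𝒞 (k + 1))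
    {i : Fin 8} (hi : i ≤ k + 1) : φ x i = 0 := by
  induction k generalizing x i with
  | zero =>
    suffices (𝒞 1).toSubmodule ≤ LinearMap.ker (LinearMap.proj i ∘ₗ φ.toLinearMap) from this hx
    refine lowerCentralSeries_succ_le fun x y _ => ?_
    change φ ⁅x, y⁆ i = 0
    obtain rfl | rfl : i = 0 ∨ i = 1 := by omega
    all_goals rw [hφ]; rfl
  | succ k ih =>
    suffices (𝒞 (k + 2)).toSubmodule ≤ LinearMap.ker (LinearMap.proj i ∘ₗ φ.toLinearMap) from
      this hx
    refine lowerCentralSeries_succ_le fun x y hy => ?_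
    change φ ⁅x, y⁆ i = 0
    rw [hφ]
    exact P.bracket_apply_eq_zero _ fun j hj => ih hy (by omega)

theorem IsAdapted.isAdaptedFamily {φ : L ≃ₗ[K] (Fin 8 → K)} {P : StructureConstants K}
    (hφ : IsAdapted φ P) : IsAdaptedFamily (fun i => φ.symm (Pi.single i 1)) P := by
  constructor
  case lie_eq_zero =>
    intro i j hij
    apply φ.injective
    rw [hφ, φ.apply_symm_apply, φ.apply_symm_apply, map_zero]
    refine P.bracket_eq_zero fun a b hab => ?_
    simp only [Pi.single_apply]
    split_ifs <;> first | omega | simp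
  all_goals
    apply φ.injective
    simp only [hφ _ _, map_add, map_smul, map_zero, φ.apply_symm_apply]
    ext k
    fin_cases k <;> simp [StructureConstants.bracket]

theorem IsAdaptedFamily.mem_lowerCentralSeries {f : Fin 8 → L} {P : StructureConstants K}
    (hf : IsAdaptedFamily f P) (hP : P.ε ≠ 0 ∨ P.η ≠ 0) (i : Fin 8) : f i ∈ 𝒞 (i - 1) := by
  have h₂ : f 2 ∈ 𝒞 1 := hf.lie_zero_one ▸ lie_mem_lowerCentralSeries_one _ _
  have h₃ : f 3 ∈ 𝒞 2 := hf.lie_zero_two ▸ lie_mem_lowerCentralSeries_succ _ h₂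
  have h₄ : f 4 ∈ 𝒞 3 := hf.lie_zero_three ▸ lie_mem_lowerCentralSeries_succ _ h₃
  have h₅ : f 5 ∈ 𝒞 4 := hf.lie_zero_four ▸ lie_mem_lowerCentralSeries_succ _ h₄
  have h₆ : f 6 ∈ 𝒞 5 := hf.lie_zero_five ▸ lie_mem_lowerCentralSeries_succ _ h₅
  have h₇ : f 7 ∈ 𝒞 6 := by
    rcases hP with hε | hη
    · exact ((𝒞 6).toSubmodule.smul_mem_iff hε).1
        (hf.lie_zero_six ▸ lie_mem_lowerCentralSeries_succ _ h₆)
    · exact ((𝒞 6).toSubmodule.smul_mem_iff hη).1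
        (hf.lie_one_six ▸ lie_mem_lowerCentralSeries_succ _ h₆)
  fin_cases i
  exacts [LieSubmodule.mem_top _, LieSubmodule.mem_top _, h₂, h₃, h₄, h₅, h₆, h₇]

/-- The matrix of the elements of a family in some coordinates is lower triangular, and its diagonal
entries are those imposed by `⁅f 0, f i⁆ = f (i + 1)` for `1 ≤ i ≤ 5`. -/
structure IsTriangular (f : Fin 8 → L) (φ : L ≃ₗ[K] (Fin 8 → K)) (x y z : K) : Prop where
  apply_eq_zero {i j : Fin 8} (h : j < i) : φ (f i) j = 0
  apply_self (i : Fin 8) :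
    φ (f i) i = ![x, y, x * y, x ^ 2 * y, x ^ 3 * y, x ^ 4 * y, x ^ 5 * y, z] i

namespace IsAdaptedFamily

variable {f : Fin 8 → L} {P Q : StructureConstants K} {φ : L ≃ₗ[K] (Fin 8 → K)} {x y z : K}

theorem smul_apply_self_seven (hf : IsAdaptedFamily f P) (hφ : IsAdapted φ Q)
    (h₆ : ∀ j < 6, φ (f 6) j = 0) :
    P.ε * φ (f 7) 7 = (Q.ε * φ (f 0) 0 + Q.η * φ (f 0) 1) * φ (f 6) 6 ∧
    P.η * φ (f 7) 7 = (Q.ε * φ (f 1) 0 + Q.η * φ (f 1) 1) * φ (f 6) 6 := by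
  have h₀₆ := congrFun (hφ (f 0) (f 6)) 7
  have h₁₆ := congrFun (hφ (f 1) (f 6)) 7
  rw [hf.lie_zero_six] at h₀₆
  rw [hf.lie_one_six] at h₁₆
  simp only [map_smul, Pi.smul_apply, smul_eq_mul, StructureConstants.bracket, Matrix.cons_val, h₆,
    Fin.reduceLT] at h₀₆ h₁₆
  exact ⟨by linear_combination h₀₆, by linear_combination h₁₆⟩

theorem apply_eq_zero_of_lt (hf : IsAdaptedFamily f P) (hφ : IsAdapted φ Q)
    (hP : P.ε ≠ 0 ∨ P.η ≠ 0) {i j : Fin 8} (hi : 2 ≤ i) (h : j < i) : φ (f i) j = 0 := by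
  obtain ⟨k, hk⟩ : ∃ k : ℕ, i.val - 1 = k + 1 := ⟨i.val - 2, by omega⟩
  exact hφ.apply_eq_zero_of_mem_lowerCentralSeries (k := k)
    (hk ▸ hf.mem_lowerCentralSeries hP i) (by omega)

theorem exists_isTriangular (hf : IsAdaptedFamily f P) (hφ : IsAdapted φ Q) (hf₇ : f 7 ≠ 0)
    (hP : P.ε ≠ 0 ∨ P.η ≠ 0) :
    ∃ x y z : K, x ≠ 0 ∧ y ≠ 0 ∧ z ≠ 0 ∧ IsTriangular f φ x y z := by
  have hzero {i j : Fin 8} (hi : 2 ≤ i) (h : j < i) : φ (f i) j = 0 :=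
    hf.apply_eq_zero_of_lt hφ hP hi h
  have h₃ : φ (f 3) 3 = φ (f 0) 0 * φ (f 2) 2 := by
    simp [← hf.lie_zero_two, hφ _ _, StructureConstants.bracket, hzero]
  have h₄ : φ (f 4) 4 = φ (f 0) 0 * φ (f 3) 3 := by
    simp [← hf.lie_zero_three, hφ _ _, StructureConstants.bracket, hzero]
  have h₅ : φ (f 5) 5 = φ (f 0) 0 * φ (f 4) 4 := by
    simp [← hf.lie_zero_four, hφ _ _, StructureConstants.bracket, hzero]
  have h₆ : φ (f 6) 6 = φ (f 0) 0 * φ (f 5) 5 := by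
    simp [← hf.lie_zero_five, hφ _ _, StructureConstants.bracket, hzero]
  have hz : φ (f 7) 7 ≠ 0 := by
    refine fun h => hf₇ (φ.injective (funext fun j => ?_))
    rw [map_zero, Pi.zero_apply]
    obtain rfl | hj := eq_or_ne j 7
    · exact h
    · exact hzero (by decide) (by omega)
  have h₆₆ : φ (f 6) 6 ≠ 0 := by
    obtain ⟨hε, hη⟩ := hf.smul_apply_self_seven hφ fun j hj => hzero (by decide) hj
    rcases hP with hP | hP
    · exact right_ne_zero_of_mul (hε ▸ mul_ne_zero hP hz)
    · exact right_ne_zero_of_mul (hη ▸ mul_ne_zero hP hz)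
  rw [h₆, h₅, h₄, h₃, mul_ne_zero_iff, mul_ne_zero_iff, mul_ne_zero_iff, mul_ne_zero_iff] at h₆₆
  obtain ⟨hx, -, -, -, h₂₂⟩ := h₆₆
  have h₁₀ : φ (f 1) 0 = 0 := by
    have h₁₂ := congrFun (hφ (f 1) (f 2)) 3
    simpa [hf.lie_one_two, StructureConstants.bracket, hzero, h₂₂] using h₁₂
  have h₂ : φ (f 2) 2 = φ (f 0) 0 * φ (f 1) 1 := by
    simp [← hf.lie_zero_one, hφ _ _, StructureConstants.bracket, h₁₀]
  refine ⟨φ (f 0) 0, φ (f 1) 1, φ (f 7) 7, hx, right_ne_zero_of_mul (h₂ ▸ h₂₂), hz, ?_, ?_⟩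
  · intro i j h
    by_cases hi : 2 ≤ i
    · exact hzero hi h
    · obtain ⟨rfl, rfl⟩ : i = 1 ∧ j = 0 := by omega
      exact h₁₀
  · intro i
    fin_cases i <;> simp [h₂, h₃, h₄, h₅, h₆] <;> ring

section Coefficients

variable (hf : IsAdaptedFamily f P) (hφ : IsAdapted φ Q) (h : IsTriangular f φ x y z)
include hf hφ h

theorem ε_mul (hη : Q.η = 0) : Q.ε * (x ^ 6 * y) = P.ε * z := by
  have hε := (hf.smul_apply_self_seven hφ fun _ => h.apply_eq_zero).1
  simp only [h.apply_self, Matrix.cons_val, hη] at hε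
  linear_combination -hε

theorem η_mul : Q.η * (x ^ 5 * y ^ 2) = P.η * z := by
  have hη := (hf.smul_apply_self_seven hφ fun _ => h.apply_eq_zero).2
  simp only [h.apply_self, h.apply_eq_zero Fin.zero_lt_one, Matrix.cons_val] at hη
  linear_combination -hη

theorem a2_mul (hx : x ≠ 0) (hy : y ≠ 0) : Q.a2 * y = P.a2 * x ^ 2 := by
  have h₁₂ := congrFun (hφ (f 1) (f 2)) 4
  simp only [hf.lie_one_two, map_add, map_smul, Pi.add_apply,
    Pi.smul_apply, smul_eq_mul, StructureConstants.bracket, Matrix.cons_val, h.apply_eq_zero,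
    h.apply_self, Fin.reduceLT] at h₁₂
  apply mul_right_cancel₀ (mul_ne_zero hx hy)
  linear_combination -h₁₂

theorem b2_mul (hx : x ≠ 0) (hy : y ≠ 0) : Q.b2 * y = P.b2 * x ^ 2 := by
  have h₂₃ := congrFun (hφ (f 2) (f 3)) 6
  simp only [hf.lie_two_three, map_add, map_smul, Pi.add_apply,
    Pi.smul_apply, smul_eq_mul, StructureConstants.bracket, Matrix.cons_val, h.apply_eq_zero,
    h.apply_self, Fin.reduceLT] at h₂₃
  apply mul_right_cancel₀ (mul_ne_zero (pow_ne_zero 3 hx) hy)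
  linear_combination -h₂₃

theorem a3_mul (hx : x ≠ 0) (hy : y ≠ 0) (hP : P.a2 = 0) (hQ : Q.a2 = 0) :
    Q.a3 * y = P.a3 * x ^ 3 := by
  have h₁₂ := congrFun (hφ (f 1) (f 2)) 5
  simp only [hf.lie_one_two, hP, hQ, map_add, map_smul, Pi.add_apply,
    Pi.smul_apply, smul_eq_mul, StructureConstants.bracket, Matrix.cons_val, h.apply_eq_zero,
    h.apply_self, Fin.reduceLT] at h₁₂
  apply mul_right_cancel₀ (mul_ne_zero hx hy)
  linear_combination -h₁₂

theorem b3_mul (hP : P.b2 = 0) (hη : Q.η = 0) (hQ : Q.b2 = 0) :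
    Q.b3 * (x ^ 3 * y ^ 2) = P.b3 * z := by
  have h₂₃ := congrFun (hφ (f 2) (f 3)) 7
  simp only [hf.lie_two_three, hP, hη, hQ, map_add, map_smul, Pi.add_apply,
    Pi.smul_apply, smul_eq_mul, StructureConstants.bracket, Matrix.cons_val, h.apply_eq_zero,
    h.apply_self, Fin.reduceLT] at h₂₃
  linear_combination -h₂₃

theorem a4_mul (hx : x ≠ 0) (hy : y ≠ 0) (hP2 : P.a2 = 0) (hP3 : P.a3 = 0) (hQ2 : Q.a2 = 0)
    (hQb2 : Q.b2 = 0) (hQ3 : Q.a3 = 0) : Q.a4 * y = P.a4 * x ^ 4 := by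
  have h₁₂ := congrFun (hφ (f 1) (f 2)) 6
  simp only [hf.lie_one_two, hP2, hP3, hQ2, hQb2, hQ3, map_add, map_smul, Pi.add_apply,
    Pi.smul_apply, smul_eq_mul, StructureConstants.bracket, Matrix.cons_val, h.apply_eq_zero,
    h.apply_self, Fin.reduceLT] at h₁₂
  apply mul_right_cancel₀ (mul_ne_zero hx hy)
  linear_combination -h₁₂

theorem a5_mul (hP2 : P.a2 = 0) (hP3 : P.a3 = 0) (hP4 : P.a4 = 0) (hη : Q.η = 0)
    (hQ2 : Q.a2 = 0) (hQb2 : Q.b2 = 0) (hQ3 : Q.a3 = 0) (hQb3 : Q.b3 = 0) (hQ4 : Q.a4 = 0) :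
    Q.a5 * (x * y ^ 2) = P.a5 * z := by
  have h₁₂ := congrFun (hφ (f 1) (f 2)) 7
  simp only [hf.lie_one_two, hP2, hP3, hP4, hη, hQ2, hQb2, hQ3, hQb3, hQ4, map_add,
    map_smul, Pi.add_apply, Pi.smul_apply, smul_eq_mul, StructureConstants.bracket, Matrix.cons_val,
    h.apply_eq_zero, h.apply_self, Fin.reduceLT] at h₁₂
  linear_combination -h₁₂

end Coefficients

end IsAdaptedFamily

end Triangular

theorem TableName.params_ε_ne_zero_or_η_ne_zero (s : TableName) :
    s.params.ε ≠ 0 ∨ s.params.η ≠ 0 := by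
  cases s <;> simp [TableName.params]

theorem TableName.eq_of_lieEquiv {s s' : TableName} (e : TableAlgebra s ≃ₗ⁅ℝ⁆ TableAlgebra s') :
    s = s' := by
  have hf := (isAdapted_coords s).isAdaptedFamily
  have hφ := (isAdapted_coords s').comp_lieEquiv e
  obtain ⟨x, y, z, hx, hy, hz, h⟩ := hf.exists_isTriangular hφ (by simp)
    s.params_ε_ne_zero_or_η_ne_zero
  have hε := hf.ε_mul hφ h
  have hη := hf.η_mul hφ h
  have ha2 := hf.a2_mul hφ h hx hy
  have hb2 := hf.b2_mul hφ h hx hy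
  have ha3 := hf.a3_mul hφ h hx hy
  have ha4 := hf.a4_mul hφ h hx hy
  have hb3 := hf.b3_mul hφ h
  have ha5 := hf.a5_mul hφ h
  have hx' (n : ℕ) : 0 ≠ x ^ n := (pow_ne_zero n hx).symm
  clear hf hφ h
  cases s <;> cases s' <;> simp_all [TableName.params]
  -- Only two algebras `a t` and `a t'` are left to compare.
  have hxy : x ^ 3 = y := mul_left_cancel₀ (mul_ne_zero (pow_ne_zero 3 hx) hy) <| by
    linear_combination hε - hb3
  rw [hxy] at ha3
  linear_combination -mul_right_cancel₀ hy ha3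

section Gradation

variable {L : Type*} [LieRing L] [LieAlgebra ℝ L]

theorem admitsNGradation_of_iSup_eigenspace_eq_top (D : LieDerivation ℝ L L)
    (hD : ⨆ n : ℕ+, End.eigenspace (D : L →ₗ[ℝ] L) (n : ℝ) = ⊤) : AdmitsNGradation L := by
  refine ⟨fun n => End.eigenspace (D : L →ₗ[ℝ] L) (n : ℝ), ?_, ⟨fun i j x y hx hy => ?_⟩⟩
  · refine (DirectSum.isInternal_submodule_iff_iSupIndep_and_iSup_eq_top _).2 ⟨?_, hD⟩
    exact (End.eigenspaces_iSupIndep _).comp (f := fun n : ℕ+ => (n : ℝ)) fun m n h => by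
      simpa using h
  · rw [End.mem_eigenspace_iff, LieDerivation.coeFn_coe] at *
    rw [D.apply_lie_eq_add, hx, hy, smul_lie, lie_smul, ← add_smul]
    push_cast
    rw [add_comm]

theorem AdmitsNGradation.exists_lieDerivation (h : AdmitsNGradation L) :
    ∃ D : LieDerivation ℝ L L, ⨆ n : ℕ+, End.eigenspace (D : L →ₗ[ℝ] L) (n : ℝ) = ⊤ := by
  obtain ⟨𝒱, hi, hg⟩ := h
  let E := LinearEquiv.ofBijective (DirectSum.coeLinearMap 𝒱) hi
  let D : L →ₗ[ℝ] L :=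
    DirectSum.toModule ℝ ℕ+ L (fun i => (i : ℝ) • (𝒱 i).subtype) ∘ₗ E.symm.toLinearMap
  have hD (i : ℕ+) (x : L) (hx : x ∈ 𝒱 i) : D x = (i : ℝ) • x := by
    have : E.symm x = DirectSum.lof ℝ ℕ+ (fun i => 𝒱 i) i ⟨x, hx⟩ := by
      rw [LinearEquiv.symm_apply_eq]
      exact (DirectSum.coeLinearMap_lof 𝒱 i ⟨x, hx⟩).symm
    simp [D, this]
  have hD' : ∀ x y, D ⁅x, y⁆ = ⁅x, D y⁆ - ⁅y, D x⁆ := fun x y => by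
    induction (hi.submodule_iSup_eq_top ▸ Submodule.mem_top : x ∈ ⨆ i, 𝒱 i) using
      Submodule.iSup_induction' with
    | mem i x hx =>
      induction (hi.submodule_iSup_eq_top ▸ Submodule.mem_top : y ∈ ⨆ i, 𝒱 i) using
        Submodule.iSup_induction' with
      | mem j y hy =>
        rw [hD i x hx, hD j y hy, hD _ _ (hg.bracket_mem hx hy), lie_smul, lie_smul, ← lie_skew x y]
        push_cast
        module
      | zero => simp
      | add y z _ _ hy hz => simp only [lie_add, add_lie, map_add, hy, hz]; abel
    | zero => simp
    | add x z _ _ hx hz => simp only [add_lie, lie_add, map_add, hx, hz]; abel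
  refine ⟨⟨D, hD'⟩, top_le_iff.1 ?_⟩
  rw [← hi.submodule_iSup_eq_top]
  exact iSup_mono fun i x hx => End.mem_eigenspace_iff.2 (hD i x hx)

end Gradation

section Converse

variable {L : Type*} [LieRing L] [LieAlgebra ℝ L] {φ : L ≃ₗ[ℝ] (Fin 8 → ℝ)}
  {P : StructureConstants ℝ}

namespace IsAdapted

theorem isFiliform (hφ : IsAdapted φ P) (hP : P.ε ≠ 0 ∨ P.η ≠ 0) : IsFiliform L := by
  have h₇ : lowerCentralSeries ℝ L L 7 = ⊥ := (LieSubmodule.eq_bot_iff _).2 fun x hx =>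
    φ.map_eq_zero_iff.1 <| funext fun i =>
      hφ.apply_eq_zero_of_mem_lowerCentralSeries (k := 6) hx (by omega)
  have h₆ : lowerCentralSeries ℝ L L 6 ≠ ⊥ := fun h => by
    have hmem := hφ.isAdaptedFamily.mem_lowerCentralSeries hP 7
    exact absurd ((LieSubmodule.eq_bot_iff _).1 h _ hmem) (by simp)
  refine ⟨.equiv φ.symm, (LieModule.isNilpotent_iff ℝ L L).2 ⟨7, h₇⟩, ?_⟩
  rw [(nilpotencyLength_eq_succ_iff ℝ L L 6).2 ⟨h₇, h₆⟩, φ.finrank_eq, finrank_fin_fun]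

/-- The derivation that is diagonal in the given coordinates, with the weights of a gradation as
its eigenvalues. -/
noncomputable def weightDerivation (hφ : IsAdapted φ P) {r ω : ℝ} (hP : P.IsHomogeneous r ω) :
    LieDerivation ℝ L L where
  toLinearMap := φ.symm.conj (LinearMap.mulLeft ℝ (StructureConstants.weights r ω))
  leibniz' x y := φ.injective <| by
    rw [← lie_skew y, sub_neg_eq_add]
    simp [LinearEquiv.conj_apply, hφ _ _, hP _ _, add_comm]

theorem admitsNGradation (hφ : IsAdapted φ P) {r ω : ℕ+} (hP : P.IsHomogeneous r ω) :
    AdmitsNGradation L := by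
  refine admitsNGradation_of_iSup_eigenspace_eq_top (hφ.weightDerivation hP) ?_
  let degree : Fin 8 → ℕ+ := ![1, r, r + 1, r + 2, r + 3, r + 4, r + 5, ω]
  have hdegree (i : Fin 8) : StructureConstants.weights (r : ℝ) ω i = degree i := by
    fin_cases i <;> simp [StructureConstants.weights, degree]
  rw [← top_le_iff, ← (Basis.ofEquivFun φ).span_eq, Submodule.span_le]
  rintro _ ⟨i, rfl⟩
  refine Submodule.mem_iSup_of_mem (degree i) (End.mem_eigenspace_iff.2 (φ.injective ?_))
  ext j
  rcases eq_or_ne j i with rfl | hj <;> simp [weightDerivation, LinearEquiv.conj_apply, *]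

end IsAdapted

theorem TableName.exists_isHomogeneous (s : TableName) :
    ∃ r ω : ℕ+, s.params.IsHomogeneous (r : ℝ) ω := by
  let w : ℕ+ × ℕ+ := match s with
    | .m0 | .m1 => (1, 7)
    | .m2 | .g _ => (2, 8)
    | .a _ | .c10 => (3, 9)
    | .d1 => (4, 10)
    | .h1 => (5, 11)
    | .b => (2, 9)
    | .k1 => (3, 11)
    | .s1 => (4, 13)
  refine ⟨w.1, w.2, ?_⟩
  cases s <;> apply StructureConstants.isHomogeneous_of_mul_eq_zero <;>
    norm_num [w, TableName.params]

end Converse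

end FiliformGraded

open FiliformGraded Module in
theorem mainTheorem1_general {L : Type*} [LieRing L] [LieAlgebra ℝ L] (hL : finrank ℝ L = 8)
    (hfil : IsFiliform L) (D : LieDerivation ℝ L L)
    (hD : Submodule.span ℝ {x | ∃ p : ℝ, p ≠ 0 ∧ D x = p • x} = ⊤) :
    ∃! s : TableName, Nonempty (L ≃ₗ⁅ℝ⁆ TableAlgebra s) := by
  obtain ⟨_, _, hfil⟩ := hfil
  obtain ⟨x, ⟨p, hp, hx⟩, y, ⟨q, hq, hy⟩, hxy⟩ :=
    IsGeneratingPair.exists_of_span_eq_top hfil (by omega) hD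
  obtain ⟨φ, P, r, ω, hφ, hP, hεη⟩ := hxy.exists_isAdapted hfil hL D hx hy hp hq
  obtain ⟨s, ψ, hψ⟩ := hφ.exists_isAdapted_params hP hεη
  let e := hψ.lieEquiv (isAdapted_coords s)
  exact ⟨s, ⟨e⟩, fun _ ⟨e'⟩ => TableName.eq_of_lieEquiv (e'.symm.trans e)⟩

theorem mainTheorem1 :
    (∀ (L : Type*) [LieRing L] [LieAlgebra ℝ L], Module.finrank ℝ L = 8 →
      FiliformGraded.IsFiliform L → FiliformGraded.AdmitsNGradation L →
        ∃! s : FiliformGraded.TableName, Nonempty (L ≃ₗ⁅ℝ⁆ FiliformGraded.TableAlgebra s)) ∧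
    (∀ s : FiliformGraded.TableName, Module.finrank ℝ (FiliformGraded.TableAlgebra s) = 8 ∧
      FiliformGraded.IsFiliform (FiliformGraded.TableAlgebra s) ∧
      FiliformGraded.AdmitsNGradation (FiliformGraded.TableAlgebra s)) := by
  refine ⟨fun L _ _ hL hfil hgrad => ?_, fun s => ?_⟩
  · obtain ⟨D, hD⟩ := hgrad.exists_lieDerivation
    refine mainTheorem1_general hL hfil D (top_le_iff.1 ?_)
    rw [← hD]
    exact iSup_le fun n x hx => Submodule.subset_span
      ⟨n, mod_cast n.ne_zero, Module.End.mem_eigenspace_iff.1 hx⟩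
  · have hs := FiliformGraded.isAdapted_coords s
    obtain ⟨r, ω, hrω⟩ := s.exists_isHomogeneous
    exact ⟨FiliformGraded.finrank_tableAlgebra s,
      hs.isFiliform s.params_ε_ne_zero_or_η_ne_zero, hs.admitsNGradation hrω⟩
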